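/- Let $f:\mathbb P^1\to\mathbb P^1$ be the quartic polynomial $f(z)=2i\bigl(z^2-\tfrac{1+i}{2}\bigr)^2$, with $f(\infty)=\infty$, and let $P_f=\bigcup_{n>0}f^{\circ n}(\Omega_f)$ be its postcritical set, where $\Omega_f$ is the set of critical points (the points where $f$ is not locally injective); in fact $P_f=\{0,1,-1,\infty\}$. Let $\mathrm{PMCG}(\mathbb P^1,P_f)$ be the pure mapping class group, that is, the group of orientation-preserving homeomorphisms of $\mathbb P^1$ fixing $P_f$ pointwise modulo the subgroup of those isotopic to the identity relative to $P_f$. Let $D\subset\mathbb C$ be a small regular neighbourhood of the segment $[0,1]$, that is, a closed topological disc with $[0,1]$ in its interior and $-1\notin D$, and let $\gamma_0=\partial D$. Let $h_0$ be a right Dehn twist about $\gamma_0$ (supported in an annular neighbourhood of $\gamma_0$ disjoint from $P_f$), or more generally any orientation-preserving homeomorphism fixing $P_f$ pointwise that represents the class of such a twist in $\mathrm{PMCG}(\mathbb P^1,P_f)$. Such $D$ and such Dehn twists exist. If $h_1:\mathbb P^1\to\mathbb P^1$ is any map with $h_0\circ f=f\circ h_1$ (a lift of $h_0$ under $f$),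 then $h_1$ does not represent an element of $\mathrm{PMCG}(\mathbb P^1,P_f)$: it is not an orientation-preserving homeomorphism fixing $P_f$ pointwise. On the other hand, Thurston's linear map $\lambda_f:\mathbb R[\mathcal S]\to\mathbb R[\mathcal S]$ is constant. Here $\mathcal S$ is the set of free homotopy classes in $\mathbb P^1-P_f$ of unoriented simple closed curves $\gamma\subset\mathbb P^1-P_f$ such that each component of $\mathbb P^1-\gamma$ contains at least two points of $P_f$, and $\lambda_f([\gamma])=\sum_{[\gamma_i]\in\mathcal S} d_i[\gamma_i]$ with $d_i=\sum_{\delta}1/\deg(\delta\to\gamma)$, the sum being over the components $\delta$ of $f^{-1}(\gamma)$ homotopic to $\gamma_i$ in $\mathbb P^1-P_f$. Thus constancy of $\lambda_f$ does not imply that every Dehn twist lifts under $f$ to a pure mapping class. -/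

import Mathlib

open Set Filter Topology CategoryTheory
open scoped Real

noncomputable section

namespace DehnTwistLift

/-- The Riemann sphere `ℙ¹ = ℂ ∪ {∞}`. -/
abbrev P1 : Type := OnePoint ℂ

/-! ### Branched covers and their postcritical sets -/

/-- The critical points of a branched cover: the points where it is not locally injective. -/
def criticalPoints (f : P1 → P1) : Set P1 :=
  {x | ¬ ∃ U ∈ 𝓝 x, InjOn f U}

/-- The postcritical set `P_f = ⋃_{n > 0} fⁿ(Ω_f)`. -/
def postcriticalSet (f : P1 → P1) : Set P1 :=
  ⋃ n : ℕ, f^[n + 1] '' criticalPoints f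

/-- The quartic polynomial `f(z) = 2i (z² - (1+i)/2)²`, extended by `f(∞) = ∞`. -/
def quartic : P1 → P1 :=
  OnePoint.map fun z : ℂ => 2 * Complex.I * (z ^ 2 - (1 + Complex.I) / 2) ^ 2

/-- The postcritical set of the quartic. -/
abbrev Pf : Set P1 := postcriticalSet quartic

/-! ### The pure mapping class group -/

/-- A homeomorphism of the sphere preserves orientation if it acts as the identity on
`H₂(ℙ¹; ℤ)`, that is, if its degree is `1`. -/
def IsOrientationPreserving (h : P1 ≃ₜ P1) : Prop :=
  ((AlgebraicTopology.singularHomologyFunctor (ModuleCat.{0} ℤ) 2).obj (ModuleCat.of ℤ ℤ)).map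
    (TopCat.ofHom (h : C(P1, P1))) = 𝟙 _

theorem isOrientationPreserving_one : IsOrientationPreserving 1 :=
  CategoryTheory.Functor.map_id _ (TopCat.of P1)

theorem IsOrientationPreserving.mul {h k : P1 ≃ₜ P1} (hh : IsOrientationPreserving h)
    (hk : IsOrientationPreserving k) : IsOrientationPreserving (h * k) := by
  have e : TopCat.ofHom ((h * k : P1 ≃ₜ P1) : C(P1, P1)) =
      TopCat.ofHom (k : C(P1, P1)) ≫ TopCat.ofHom (h : C(P1, P1)) := rfl
  unfold IsOrientationPreserving at *
  rw [e, Functor.map_comp, hh, hk, Category.comp_id]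

theorem IsOrientationPreserving.inv {h : P1 ≃ₜ P1} (hh : IsOrientationPreserving h) :
    IsOrientationPreserving h⁻¹ := by
  have e : TopCat.ofHom ((h⁻¹ : P1 ≃ₜ P1) : C(P1, P1)) ≫ TopCat.ofHom (h : C(P1, P1)) =
      𝟙 (TopCat.of P1) := by
    ext x
    exact h.apply_symm_apply x
  unfold IsOrientationPreserving at *
  have := congrArg (((AlgebraicTopology.singularHomologyFunctor
    (ModuleCat.{0} ℤ) 2).obj (ModuleCat.of ℤ ℤ)).map) e
  rw [Functor.map_comp, hh, Category.comp_id] at this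
  exact this.trans (CategoryTheory.Functor.map_id _ _)

/-- The group of orientation-preserving homeomorphisms of `ℙ¹` fixing `P` pointwise. -/
def pureHomeo (P : Set P1) : Subgroup (P1 ≃ₜ P1) where
  carrier := {h | IsOrientationPreserving h ∧ ∀ p ∈ P, h p = p}
  one_mem' := ⟨isOrientationPreserving_one, fun _ _ => rfl⟩
  mul_mem' := by
    rintro a b ⟨ha, ha'⟩ ⟨hb, hb'⟩
    refine ⟨ha.mul hb, fun p hp => ?_⟩
    change a (b p) = p
    rw [hb' p hp, ha' p hp]
  inv_mem' := by
    rintro a ⟨ha, ha'⟩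
    refine ⟨ha.inv, fun p hp => ?_⟩
    change a.symm p = p
    rw [Homeomorph.symm_apply_eq, ha' p hp]

/-- `H` is an isotopy relative to `P` from the identity to `h`. -/
structure IsIsotopyFromId (P : Set P1) (h : P1 → P1) (H : unitInterval × P1 → P1) : Prop where
  continuous : Continuous H
  zero : ∀ x, H (0, x) = x
  one : ∀ x, H (1, x) = h x
  homeo : ∀ t, IsHomeomorph fun x => H (t, x)
  fixes : ∀ t, ∀ p ∈ P, H (t, p) = p

theorem IsIsotopyFromId.inv {P : Set P1} {h : P1 ≃ₜ P1} {H : unitInterval × P1 → P1}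
    (hH : IsIsotopyFromId P h H) : ∃ K, IsIsotopyFromId P h.symm K := by
  have hb : IsHomeomorph fun q : unitInterval × P1 => (q.1, H q) := by
    rw [isHomeomorph_iff_continuous_bijective]
    refine ⟨continuous_fst.prodMk hH.continuous, ?_, ?_⟩
    · rintro ⟨t, x⟩ ⟨t', x'⟩ hq
      simp only [Prod.mk.injEq] at hq
      obtain ⟨rfl, h2⟩ := hq
      rw [(hH.homeo t).injective h2]
    · rintro ⟨t, y⟩
      obtain ⟨x, hx⟩ := (hH.homeo t).surjective y
      exact ⟨(t, x), Prod.ext rfl hx⟩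
  let e := hb.homeomorph
  have he : ∀ t x, e (t, x) = (t, H (t, x)) := fun _ _ => rfl
  have hs : ∀ t x, e.symm (t, H (t, x)) = (t, x) := fun t x => by
    rw [← he, e.symm_apply_apply]
  have hs2 : ∀ t y, H (t, (e.symm (t, y)).2) = y := fun t y => by
    obtain ⟨x, rfl⟩ := (hH.homeo t).surjective y
    simp only [hs]
  refine ⟨fun q => (e.symm q).2, ⟨continuous_snd.comp e.symm.continuous, fun x => ?_, fun x => ?_,
    fun t => ?_, fun t p hp => ?_⟩⟩
  · have := hs 0 x
    rw [hH.zero] at this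
    simp [this]
  · have := hs 1 (h.symm x)
    rw [hH.one, h.apply_symm_apply] at this
    simp [this]
  · rw [isHomeomorph_iff_continuous_bijective]
    refine ⟨continuous_snd.comp (e.symm.continuous.comp (by fun_prop)), fun x y hxy => ?_,
      fun x => ⟨H (t, x), by simp only [hs]⟩⟩
    have := congrArg (fun z => H (t, z)) hxy
    simpa only [hs2] using this
  · have := hs t p
    rw [hH.fixes t p hp] at this
    simp [this]

/-- The subgroup of those pure homeomorphisms that are isotopic to the identity relative
to `P`. -/
def isotopicToId (P : Set P1) : Subgroup (pureHomeo P) where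
  carrier := {h | ∃ H, IsIsotopyFromId P (h : P1 ≃ₜ P1) H}
  one_mem' := ⟨fun q => q.2, continuous_snd, fun _ => rfl, fun _ => rfl,
    fun _ => IsHomeomorph.id, fun _ _ _ => rfl⟩
  mul_mem' := by
    rintro a b ⟨H, hH⟩ ⟨K, hK⟩
    refine ⟨fun q => H (q.1, K q), ⟨hH.continuous.comp (continuous_fst.prodMk hK.continuous),
      fun x => ?_, fun x => ?_, fun t => (hH.homeo t).comp (hK.homeo t), fun t p hp => ?_⟩⟩
    · simp only [hK.zero, hH.zero]
    · simp only [hK.one, hH.one]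
      rfl
    · simp only [hK.fixes t p hp, hH.fixes t p hp]
  inv_mem' := by
    rintro a ⟨H, hH⟩
    exact hH.inv

instance (P : Set P1) : (isotopicToId P).Normal where
  conj_mem := by
    rintro a ⟨H, hH⟩ g
    refine ⟨fun q => (g : P1 ≃ₜ P1) (H (q.1, (g : P1 ≃ₜ P1).symm q.2)),
      ⟨(g : P1 ≃ₜ P1).continuous.comp (hH.continuous.comp (continuous_fst.prodMk
        ((g : P1 ≃ₜ P1).symm.continuous.comp continuous_snd))), fun x => ?_, fun x => ?_,
      fun t => ((g : P1 ≃ₜ P1).isHomeomorph.comp (hH.homeo t)).comp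
        (g : P1 ≃ₜ P1).symm.isHomeomorph, fun t p hp => ?_⟩⟩
    · simp only [hH.zero, Homeomorph.apply_symm_apply]
    · simp only [hH.one]
      rfl
    · have h1 : (g : P1 ≃ₜ P1).symm p = p := (Homeomorph.symm_apply_eq _).2 (g.2.2 p hp).symm
      simp only [h1, hH.fixes t p hp, g.2.2 p hp]

/-- The pure mapping class group `PMCG(ℙ¹, P)`. -/
abbrev PMCG (P : Set P1) : Type := pureHomeo P ⧸ isotopicToId P

/-- The class of a pure homeomorphism in the pure mapping class group. -/
def mappingClass (P : Set P1) (h : pureHomeo P) : PMCG P := QuotientGroup.mk h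

/-! ### Dehn twists -/

/-- The closed round annulus `1 ≤ |z| ≤ 2`. -/
def annulus : Set ℂ := {z | 1 ≤ ‖z‖ ∧ ‖z‖ ≤ 2}

/-- The standard right twist `(r, θ) ↦ (r, θ - 2π (r - 1))` of the annulus `1 ≤ r ≤ 2`; an arc
that crosses the annulus turns to the right under it. -/
def stdRightTwist (z : ℂ) : ℂ :=
  z * Complex.exp (-(2 * π * (‖z‖ - 1) : ℝ) * Complex.I)

/-- A local homeomorphism `g` from the plane to the sphere, finite at `z`, preserves orientation
at `z`: the images of small counterclockwise circles about `z` have winding number `+1` about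
`g z`. The winding number is expressed by a continuous branch `ℓ` of `log (g - g z)` along the
circle, which increases by `2πi` in one turn. -/
def PreservesOrientationAt (g : ℂ → P1) (z : ℂ) : Prop :=
  ∃ w : ℂ, g z = (w : P1) ∧ ∀ᶠ r in 𝓝[>] (0 : ℝ), ∃ ℓ : ℝ → ℂ, Continuous ℓ ∧
    (∀ t, g (circleMap z r t) = ((w + Complex.exp (ℓ t) : ℂ) : P1)) ∧
    ∀ t, ℓ (t + 2 * π) = ℓ t + 2 * π * Complex.I

/-- `h` is a right Dehn twist of `(ℙ¹, P)` about the simple closed curve `γ`: there is an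
orientation-preserving parametrization `φ` of an annular neighbourhood of `γ` disjoint from `P`,
with core curve `γ`, such that `h` is the standard right twist in the coordinates `φ`, and the
identity outside the annulus. -/
def IsRightDehnTwist (P : Set P1) (γ : Set P1) (h : P1 → P1) : Prop :=
  ∃ φ : OpenPartialHomeomorph ℂ P1,
    annulus ⊆ φ.source ∧
    (∀ z ∈ annulus, φ z ≠ OnePoint.infty → PreservesOrientationAt φ z) ∧
    φ '' Metric.sphere (0 : ℂ) (3 / 2) = γ ∧
    Disjoint (φ '' annulus) P ∧
    (∀ z ∈ annulus, h (φ z) = φ (stdRightTwist z)) ∧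
    ∀ x, x ∉ φ '' annulus → h x = x

/-- `D` is a small regular neighbourhood of the segment `[0,1]` in the plane: a closed
(tame) topological disc with `[0,1]` in its interior that does not meet the remaining
finite postcritical point `-1` of the quartic. -/
def IsRegularNhdUnitSegment (D : Set ℂ) : Prop :=
  (∃ Φ : ℂ ≃ₜ ℂ, D = Φ '' Metric.closedBall (0 : ℂ) 1) ∧
    segment ℝ (0 : ℂ) 1 ⊆ interior D ∧ (-1 : ℂ) ∉ D

/-- The boundary of a subset of the plane, as a subset of the sphere. -/
def boundaryCurve (D : Set ℂ) : Set P1 := (fun z : ℂ => (z : P1)) '' frontier D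

/-! ### Thurston's linear map -/

/-- `c` parametrizes the simple closed curve `γ` in `ℙ¹ - P`. -/
def Parametrizes {P : Set P1} (c : C(Circle, (Pᶜ : Set P1))) (γ : Set P1) : Prop :=
  Function.Injective c ∧ range (fun t => (c t : P1)) = γ

/-- Free homotopy in `ℙ¹ - P` of unoriented simple closed curves. -/
def FreelyHomotopic (P : Set P1) (γ δ : Set P1) : Prop :=
  ∃ c d : C(Circle, (Pᶜ : Set P1)), Parametrizes c γ ∧ Parametrizes d δ ∧ c.Homotopic d

/-- The simple closed curves `γ` in `ℙ¹ - P` such that each component of `ℙ¹ - γ` contains at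
least two points of `P`. The simple closed curves in the sphere are the images of a round circle
under homeomorphisms of the sphere (Schoenflies). -/
def IsEssentialCurve (P : Set P1) (γ : Set P1) : Prop :=
  (∃ Φ : P1 ≃ₜ P1, γ = Φ '' ((fun z : ℂ => (z : P1)) '' Metric.sphere (0 : ℂ) 1)) ∧
    Disjoint γ P ∧ ∀ x ∉ γ, 2 ≤ (connectedComponentIn γᶜ x ∩ P).encard

theorem IsEssentialCurve.freelyHomotopic_refl {P γ : Set P1} (h : IsEssentialCurve P γ) :
    FreelyHomotopic P γ γ := by
  obtain ⟨⟨Φ, rfl⟩, hd, -⟩ := h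
  have hm : ∀ t : Circle, Φ ((t : ℂ) : P1) ∈ Pᶜ := fun t ht =>
    hd.le_bot ⟨⟨_, ⟨(t : ℂ), by simp [Circle.norm_coe], rfl⟩, rfl⟩, ht⟩
  let c : C(Circle, (Pᶜ : Set P1)) := ⟨fun t => ⟨Φ ((t : ℂ) : P1), hm t⟩,
    (Φ.continuous.comp (OnePoint.continuous_coe.comp continuous_subtype_val)).subtype_mk _⟩
  have hc : Parametrizes c (Φ '' ((fun z : ℂ => (z : P1)) '' Metric.sphere (0 : ℂ) 1)) := by
    refine ⟨fun s t hst => ?_, ?_⟩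
    · have := Φ.injective (congrArg Subtype.val hst)
      exact Subtype.ext (OnePoint.coe_injective this)
    · ext x
      constructor
      · rintro ⟨t, rfl⟩
        exact ⟨_, ⟨(t : ℂ), by simp [Circle.norm_coe], rfl⟩, rfl⟩
      · rintro ⟨_, ⟨z, hz, rfl⟩, rfl⟩
        exact ⟨⟨z, by simpa [Submonoid.unitSphere] using hz⟩, rfl⟩
  exact ⟨c, c, hc, hc, ContinuousMap.Homotopic.refl c⟩

theorem FreelyHomotopic.symm {P γ δ : Set P1} (h : FreelyHomotopic P γ δ) :
    FreelyHomotopic P δ γ := by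
  obtain ⟨c, d, hc, hd, H⟩ := h
  exact ⟨d, c, hd, hc, H.symm⟩

theorem FreelyHomotopic.trans {P γ δ ε : Set P1} (h : FreelyHomotopic P γ δ)
    (h' : FreelyHomotopic P δ ε) : FreelyHomotopic P γ ε := by
  obtain ⟨c, d, hc, hd, H⟩ := h
  obtain ⟨d', e, hd', he, H'⟩ := h'
  -- reparametrize `c` by the homeomorphism `ρ = d⁻¹ ∘ d'` of the circle
  have hr : range d = range d' := by
    have := hd.2.trans hd'.2.symm
    apply Subtype.val_injective.image_injective
    rw [← range_comp, ← range_comp]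
    exact this
  have emb : IsEmbedding d := (d.continuous.isClosedEmbedding hd.1).isEmbedding
  choose ρ hρ using fun t : Circle => (hr ▸ mem_range_self t : d' t ∈ range d)
  have hρc : Continuous ρ := by
    rw [emb.continuous_iff]
    exact d'.continuous.congr fun t => (hρ t).symm
  have hρi : Function.Injective ρ := fun s t hst => hd'.1 (by rw [← hρ s, ← hρ t, hst])
  have hρs : Function.Surjective ρ := fun s => by
    obtain ⟨t, ht⟩ := (hr ▸ mem_range_self s : d s ∈ range d')
    exact ⟨t, hd.1 (by rw [hρ, ht])⟩
  let r : C(Circle, Circle) := ⟨ρ, hρc⟩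
  have hd'r : d.comp r = d' := ContinuousMap.ext hρ
  refine ⟨c.comp r, e, ⟨hc.1.comp hρi, ?_⟩, he, ?_⟩
  · rw [← hc.2]
    exact hρs.range_comp (fun t => (c t : P1))
  · exact ((H.comp (ContinuousMap.Homotopic.refl r)).trans (hd'r ▸ .refl _)).trans H'

/-- Free homotopy as an equivalence relation on the essential curves. -/
def curveSetoid (P : Set P1) : Setoid {γ : Set P1 // IsEssentialCurve P γ} where
  r γ δ := FreelyHomotopic P γ δ
  iseqv := ⟨fun γ => γ.2.freelyHomotopic_refl, fun h => h.symm, fun h h' => h.trans h'⟩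

/-- The set `𝒮` of free homotopy classes of essential curves in `ℙ¹ - P`. -/
abbrev CurveClass (P : Set P1) : Type := Quotient (curveSetoid P)

/-- The components of `f⁻¹(γ)`. -/
def preimageComponents (f : P1 → P1) (γ : Set P1) : Set (Set P1) :=
  {δ | ∃ x ∈ f ⁻¹' γ, δ = connectedComponentIn (f ⁻¹' γ) x}

/-- The degree of the covering `f : δ → γ`: the number of points of `δ` over a point of `γ`
(it is the same for all points of `γ`). -/
def coveringDegree (f : P1 → P1) (δ γ : Set P1) : ℕ :=
  ⨆ y : γ, (δ ∩ f ⁻¹' {(y : P1)}).ncard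

/-- The coefficient `d_i` of `λ_f [γ]` at the class `[γ_i]`: the sum of `1 / deg (δ → γ)` over the
components `δ` of `f⁻¹(γ)` that are homotopic to `γ_i`. -/
def thurstonCoeff (f : P1 → P1) (P : Set P1) (a b : CurveClass P) : ℝ :=
  ∑ᶠ δ ∈ {δ | δ ∈ preimageComponents f a.out.1 ∧ FreelyHomotopic P δ b.out.1},
    (1 : ℝ) / coveringDegree f δ a.out.1

/-- Thurston's linear map `λ_f : ℝ[𝒮] → ℝ[𝒮]` with respect to the marked set `P`. -/
def thurstonLinearMap (f : P1 → P1) (P : Set P1) :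
    (CurveClass P →₀ ℝ) →ₗ[ℝ] (CurveClass P →₀ ℝ) :=
  Finsupp.linearCombination ℝ fun a => ∑ᶠ b, Finsupp.single b (thurstonCoeff f P a b)

end DehnTwistLift

end

open DehnTwistLift

/-!
An essential curve `γ` winds around exactly two of the points `0, 1, -1`, and the set of points
around which a loop winds is invariant under free homotopy in the complement of `P_f`. Every loop in
`f⁻¹(γ)`, however, winds around all three of them or around at most one, because `f` is the
composition of `z ↦ z²` and `z ↦ 2i(z - κ)²`, where `κ = (1 + i) / 2`, and each of these maps is
injective on a connected set whose image is separated from its critical values by a connected set.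
So no component of `f⁻¹(γ)` is homotopic to an essential curve, and `λ_f = 0`.

For the twists, let `β` be the path `f([0, 1])` from `-1` to `1` and let `τ` be a planar map fixing
`0`, `1` and `-1`. The change of a continuous logarithm of `τ (β s) / β s` along `[0, 1]` is a
multiple `2πi n`, and `n` depends only on the mapping class of `τ`. A twist about a curve that
separates `0` and `1` from `-1` makes `n` odd. If `σ` is a pure lift of `τ` under `f`, then
`τ (β s) / β s` is the square of `(σ s ^ 2 - κ) / (s ^ 2 - κ)`, which equals `1` at both ends, so
that `n` is even.
-/

noncomputable section

namespace DehnTwistLift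

/-! ### Continuous logarithms -/

theorem eq_of_exp_eq_exp {Y : Type*} [TopologicalSpace Y] [PreconnectedSpace Y] {m : Y → ℂ}
    (hm : Continuous m) (h : ∀ y y', Complex.exp (m y) = Complex.exp (m y')) (y y' : Y) :
    m y = m y' :=
  Complex.isCoveringMap_exp.const_of_comp hm (fun a b => Subtype.ext (h a b)) y y'

theorem exists_continuous_log {Y : Type*} [TopologicalSpace Y] [SimplyConnectedSpace Y]
    [LocallyPathConnectedSpace Y] {u : Y → ℂ} (hu : Continuous u) (h0 : ∀ y, u y ≠ 0) :
    ∃ ℓ : Y → ℂ, Continuous ℓ ∧ ∀ y, Complex.exp (ℓ y) = u y := by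
  obtain ⟨y₀⟩ : Nonempty Y := inferInstance
  obtain ⟨F, ⟨-, hF⟩, -⟩ := Complex.isCoveringMapOn_exp.existsUnique_continuousMap_lifts
    ⟨u, hu⟩ (a₀ := y₀) (Complex.exp_log (h0 y₀)) h0
  exact ⟨F, F.continuous, congrFun hF⟩

theorem exists_continuous_log_unitInterval {u : unitInterval → ℂ} (hu : Continuous u)
    (h0 : ∀ y, u y ≠ 0) :
    ∃ ℓ : unitInterval → ℂ, Continuous ℓ ∧ ∀ y, Complex.exp (ℓ y) = u y := by
  obtain ⟨ℓ, hℓ, he⟩ := exists_continuous_log (hu.comp (continuous_projIcc (h := zero_le_one)))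
    fun t => h0 _
  exact ⟨fun t => ℓ t, hℓ.comp continuous_subtype_val,
    fun t => by rw [he, Function.comp_apply, projIcc_val]⟩

/-- The nowhere vanishing function `u` has a continuous logarithm on all of `Y`, and `c` is the
difference of its values at `y₁` and `y₀`. For `y₁ = y₀` this just says that `u` has a continuous
logarithm and `c = 0`. -/
def HasLogVariation {Y : Type*} [TopologicalSpace Y] (y₀ y₁ : Y) (u : Y → ℂ) (c : ℂ) : Prop :=
  ∃ ℓ : Y → ℂ, Continuous ℓ ∧ (∀ y, Complex.exp (ℓ y) = u y) ∧ ℓ y₁ - ℓ y₀ = c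

namespace HasLogVariation

variable {Y : Type*} [TopologicalSpace Y] {y₀ y₁ : Y} {u v : Y → ℂ} {c c' : ℂ}

theorem mul (hu : HasLogVariation y₀ y₁ u c) (hv : HasLogVariation y₀ y₁ v c') :
    HasLogVariation y₀ y₁ (fun y => u y * v y) (c + c') := by
  obtain ⟨ℓ, hℓ, he, rfl⟩ := hu
  obtain ⟨m, hm, he', rfl⟩ := hv
  exact ⟨fun y => ℓ y + m y, hℓ.add hm, fun y => by rw [Complex.exp_add, he, he'], by ring⟩

theorem inv (hu : HasLogVariation y₀ y₁ u c) :
    HasLogVariation y₀ y₁ (fun y => (u y)⁻¹) (-c) := by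
  obtain ⟨ℓ, hℓ, he, rfl⟩ := hu
  exact ⟨fun y => -ℓ y, hℓ.neg, fun y => by rw [Complex.exp_neg, he], by ring⟩

theorem const {a : ℂ} (ha : a ≠ 0) : HasLogVariation y₀ y₁ (fun _ => a) 0 :=
  ⟨fun _ => Complex.log a, continuous_const, fun _ => Complex.exp_log ha, sub_self _⟩

theorem congr (hu : HasLogVariation y₀ y₁ u c) (h : ∀ y, u y = v y) :
    HasLogVariation y₀ y₁ v c :=
  (funext h : u = v) ▸ hu

theorem ne_zero (hu : HasLogVariation y₀ y₁ u c) (y : Y) : u y ≠ 0 := by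
  obtain ⟨ℓ, -, he, -⟩ := hu
  exact he y ▸ Complex.exp_ne_zero _

theorem of_mem_slitPlane (hu : Continuous u) (hs : ∀ y, u y ∈ Complex.slitPlane)
    (h : u y₁ = u y₀) : HasLogVariation y₀ y₁ u 0 :=
  ⟨fun y => Complex.log (u y), hu.clog hs,
    fun y => Complex.exp_log (Complex.slitPlane_ne_zero (hs y)), by simp only [h, sub_self]⟩

theorem unique [PreconnectedSpace Y] (h : HasLogVariation y₀ y₁ u c)
    (h' : HasLogVariation y₀ y₁ u c') : c = c' := by
  have hu := h.ne_zero
  obtain ⟨ℓ, hℓ, he, rfl⟩ := h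
  obtain ⟨m, hm, he', rfl⟩ := h'
  have key := eq_of_exp_eq_exp (m := fun y => ℓ y - m y) (hℓ.sub hm)
    (fun y y' => by simp only [Complex.exp_sub, he, he', div_self (hu _)]) y₀ y₁
  linear_combination -key

/-- Small perturbations of `u` leave the variation of the logarithm unchanged because the
principal branch applies to their ratio with `u`. -/
theorem iff_of_div_mem_slitPlane {k : ℂ} (hu : Continuous u) (hv : Continuous v)
    (hu0 : ∀ y, u y ≠ 0) (huk : u y₁ = k * u y₀) (hvk : v y₁ = k * v y₀)
    (hs : ∀ y, v y / u y ∈ Complex.slitPlane) :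
    HasLogVariation y₀ y₁ u c ↔ HasLogVariation y₀ y₁ v c := by
  have hv0 : ∀ y, v y ≠ 0 := fun y => (div_ne_zero_iff.1 (Complex.slitPlane_ne_zero (hs y))).1
  have hk : k ≠ 0 := left_ne_zero_of_mul (huk ▸ hu0 y₁)
  have ratio : HasLogVariation y₀ y₁ (fun y => v y / u y) 0 :=
    .of_mem_slitPlane (hv.div hu hu0) hs (by rw [huk, hvk, mul_div_mul_left _ _ hk])
  refine ⟨fun h => ?_, fun h => ?_⟩
  · simpa using (h.mul ratio).congr fun y => mul_div_cancel₀ _ (hu0 y)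
  · simpa using (h.mul ratio.inv).congr fun y => by
      rw [inv_div, mul_div_cancel₀ _ (hv0 y)]

end HasLogVariation

theorem eventually_forall_div_mem_slitPlane {X Y : Type*} [TopologicalSpace X]
    [TopologicalSpace Y] [CompactSpace Y] {G : X → Y → ℂ}
    (hG : Continuous fun q : X × Y => G q.1 q.2) (h0 : ∀ x y, G x y ≠ 0) (x : X) :
    ∀ᶠ x' in 𝓝 x, ∀ y, G x' y / G x y ∈ Complex.slitPlane := by
  have hx : Continuous (G x) := hG.comp (by fun_prop : Continuous fun y => (x, y))
  have hc : Continuous fun q : X × Y => G q.1 q.2 / G x q.2 :=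
    hG.div (hx.comp continuous_snd) fun q => h0 _ _
  have near : ∀ y ∈ (univ : Set Y), ∀ᶠ q : X × Y in 𝓝 (x, y),
      G q.1 q.2 / G x q.2 ∈ Complex.slitPlane := fun y _ =>
    hc.continuousAt.eventually (Complex.isOpen_slitPlane.mem_nhds (by simp [div_self (h0 x y)]))
  simpa using isCompact_univ.eventually_forall_of_forall_eventually near

theorem HasLogVariation.of_family {X Y : Type*} [TopologicalSpace X] [PreconnectedSpace X]
    [TopologicalSpace Y] [CompactSpace Y] {y₀ y₁ : Y} {G : X → Y → ℂ} {c k : ℂ}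
    (hG : Continuous fun q : X × Y => G q.1 q.2) (h0 : ∀ x y, G x y ≠ 0)
    (hk : ∀ x, G x y₁ = k * G x y₀) (x₀ x₁ : X) (h : HasLogVariation y₀ y₁ (G x₀) c) :
    HasLogVariation y₀ y₁ (G x₁) c := by
  have hGx : ∀ x, Continuous (G x) := fun x => hG.comp (by fun_prop : Continuous fun y => (x, y))
  have locally_const : ∀ x, ∀ᶠ x' in 𝓝 x,
      (HasLogVariation y₀ y₁ (G x) c ↔ HasLogVariation y₀ y₁ (G x') c) := fun x =>
    (eventually_forall_div_mem_slitPlane hG h0 x).mono fun x' hx' =>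
      HasLogVariation.iff_of_div_mem_slitPlane (hGx x) (hGx x') (h0 x) (hk x) (hk x') hx'
  have clopen : IsClopen {x | HasLogVariation y₀ y₁ (G x) c} :=
    ⟨⟨isOpen_iff_mem_nhds.2 fun x hx => (locally_const x).mono fun x' h' => (not_congr h').1 hx⟩,
      isOpen_iff_mem_nhds.2 fun x hx => (locally_const x).mono fun x' h' => h'.1 hx⟩
  exact eq_univ_iff_forall.1 (clopen.eq_univ ⟨x₀, h⟩) x₁

/-- The loop `c` in the plane winds around `p`: it avoids `p` and has nonzero winding number
about it, or it passes through `p`. Encoded as the absence of a continuous logarithm of `c - p`. -/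
def WindsAround (c : Circle → ℂ) (p : ℂ) : Prop :=
  ¬ HasLogVariation (1 : Circle) 1 (fun t => c t - p) 0

theorem windsAround_coe_zero : WindsAround (fun t => t) 0 := by
  rintro ⟨ℓ, hℓ, he, -⟩
  have key := eq_of_exp_eq_exp (m := fun θ : ℝ => ℓ (Circle.exp θ) - θ * Complex.I)
    (by fun_prop) (fun θ θ' => by simp [Complex.exp_sub, he]) 0 (2 * π)
  simp only [Complex.ofReal_zero, zero_mul, sub_zero, Circle.exp_zero, Circle.exp_two_pi] at key
  refine Complex.two_pi_I_ne_zero ?_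
  push_cast at key
  linear_combination key

theorem windsAround_coe {a : ℂ} (ha : ‖a‖ < 1) : WindsAround (fun t => t) a := by
  intro h
  refine windsAround_coe_zero ?_
  have key := HasLogVariation.of_family (G := fun (s : unitInterval) (t : Circle) =>
    (t : ℂ) - (s : ℝ) * a) (y₀ := 1) (y₁ := 1) (k := 1) (c := 0) (by fun_prop)
    (fun s t h0 => ?_) (fun s => by simp) 1 0 (h.congr fun t => by simp)
  · exact key.congr fun t => by simp
  · have norm_eq : ‖(t : ℂ)‖ = ‖((s : ℝ) : ℂ) * a‖ := by rw [sub_eq_zero.1 h0]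
    rw [Circle.norm_coe, norm_mul, Complex.norm_real, Real.norm_of_nonneg s.2.1] at norm_eq
    nlinarith [s.2.1, s.2.2, norm_nonneg a]

theorem not_windsAround_coe {a : ℂ} (ha : 1 < ‖a‖) : ¬ WindsAround (fun t => t) a := by
  have ha0 : a ≠ 0 := norm_pos_iff.1 (zero_lt_one.trans ha)
  have near_one : HasLogVariation (1 : Circle) 1 (fun t => 1 + -((t : ℂ) / a)) 0 := by
    refine .of_mem_slitPlane (by fun_prop) (fun t => Complex.mem_slitPlane_of_norm_lt_one ?_) rfl
    rwa [norm_neg, norm_div, Circle.norm_coe, div_lt_one (zero_lt_one.trans ha)]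
  refine not_not.2 (add_zero (0 : ℂ) ▸
    (near_one.mul (.const (neg_ne_zero.2 ha0))).congr fun t => ?_)
  field_simp
  ring

/-! ### Topology of the sphere -/

theorem coclosedCompact_complex : coclosedCompact ℂ = Bornology.cobounded ℂ := by
  rw [coclosedCompact_eq_cocompact, Metric.cobounded_eq_cocompact]

/-- The inversion `z ↦ 1 / z` of the sphere, which exchanges `0` and `∞`. -/
def sphereInv (x : P1) : P1 :=
  x.elim ((0 : ℂ) : P1) fun z => if z = 0 then OnePoint.infty else ((z⁻¹ : ℂ) : P1)

theorem sphereInv_infty : sphereInv OnePoint.infty = ((0 : ℂ) : P1) := rfl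

theorem sphereInv_zero : sphereInv ((0 : ℂ) : P1) = OnePoint.infty := if_pos rfl

theorem sphereInv_coe {z : ℂ} (hz : z ≠ 0) : sphereInv (z : P1) = ((z⁻¹ : ℂ) : P1) := if_neg hz

theorem sphereInv_involutive : Function.Involutive sphereInv := by
  intro x
  induction x using OnePoint.rec with
  | infty => rw [sphereInv_infty, sphereInv_zero]
  | coe z =>
    obtain rfl | hz := eq_or_ne z 0
    · rw [sphereInv_zero, sphereInv_infty]
    · rw [sphereInv_coe hz, sphereInv_coe (inv_ne_zero hz), inv_inv]

theorem continuous_sphereInv : Continuous sphereInv := by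
  have on_units : ∀ z : ℂ, z ≠ 0 → ((z⁻¹ : ℂ) : P1) = sphereInv z := fun z hz =>
    (sphereInv_coe hz).symm
  rw [continuous_iff_continuousAt]
  intro x
  induction x using OnePoint.rec with
  | infty =>
    rw [OnePoint.continuousAt_infty', coclosedCompact_complex]
    exact ((OnePoint.continuous_coe.tendsto 0).comp tendsto_inv₀_cobounded).congr'
      ((Bornology.eventually_ne_cobounded 0).mono on_units)
  | coe z =>
    rw [OnePoint.continuousAt_coe]
    obtain rfl | hz := eq_or_ne z 0
    · rw [continuousAt_iff_punctured_nhds, Function.comp_apply, sphereInv_zero]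
      exact ((OnePoint.tendsto_coe_infty.mono_left coclosedCompact_complex.ge).comp
        tendsto_inv₀_nhdsNE_zero).congr' (eventually_mem_nhdsWithin.mono on_units)
    · exact (OnePoint.continuous_coe.continuousAt.comp (continuousAt_inv₀ hz)).congr
        ((isOpen_ne.eventually_mem hz).mono on_units)

/-- The inversion `z ↦ 1 / z` as a homeomorphism of the sphere. -/
def sphereInvHomeo : P1 ≃ₜ P1 where
  toEquiv := sphereInv_involutive.toPerm
  continuous_toFun := continuous_sphereInv
  continuous_invFun := continuous_sphereInv

theorem exists_isPathConnected_subset_of_mem_nhds_coe {z : ℂ} {t : Set P1} (ht : t ∈ 𝓝 (z : P1)) :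
    ∃ s ∈ 𝓝 (z : P1), IsPathConnected s ∧ s ⊆ t := by
  rw [OnePoint.nhds_coe_eq] at ht ⊢
  obtain ⟨s, ⟨hs, hp⟩, hst⟩ := (path_connected_basis z).mem_iff.1 ht
  exact ⟨(↑) '' s, image_mem_map hs, hp.image OnePoint.continuous_coe,
    (image_mono hst).trans (image_preimage_subset _ _)⟩

instance : LocallyPathConnectedSpace P1 where
  path_connected_basis x := by
    rw [hasBasis_self]
    intro t ht
    induction x using OnePoint.rec with
    | infty =>
      obtain ⟨s, hs, hp, hst⟩ := exists_isPathConnected_subset_of_mem_nhds_coe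
        (continuous_sphereInv.continuousAt.preimage_mem_nhds (by rwa [sphereInv_zero]))
      have hs' : sphereInv '' s ∈ 𝓝 (sphereInv ((0 : ℂ) : P1)) :=
        sphereInvHomeo.isOpenMap.image_mem_nhds hs
      rw [sphereInv_zero] at hs'
      exact ⟨sphereInv '' s, hs', hp.image continuous_sphereInv, image_subset_iff.2 hst⟩
    | coe z => exact exists_isPathConnected_subset_of_mem_nhds_coe ht

theorem exists_continuous_coe_eq {X Y : Type*} [TopologicalSpace X] [TopologicalSpace Y]
    {u : Y → OnePoint X} (hu : Continuous u) (h : ∀ y, u y ≠ OnePoint.infty) :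
    ∃ v : Y → X, Continuous v ∧ ∀ y, (v y : OnePoint X) = u y := by
  choose v hv using fun y => OnePoint.ne_infty_iff_exists.1 (h y)
  exact ⟨v, OnePoint.isOpenEmbedding_coe.isInducing.continuous_iff.2
    (hu.congr fun y => (hv y).symm), hv⟩

theorem isOpenMap_onePointMap {X Y : Type*} [TopologicalSpace X] [TopologicalSpace Y] [T2Space Y]
    [WeaklyLocallyCompactSpace Y] {u : X → Y} (hu : Continuous u) (ho : IsOpenMap u)
    (hs : Function.Surjective u) (hp : Tendsto u (coclosedCompact X) (coclosedCompact Y)) :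
    IsOpenMap (OnePoint.map u) := by
  rw [isOpenMap_iff_nhds_le]
  intro x
  induction x using OnePoint.rec with
  | infty =>
    intro t ht
    obtain ⟨s, hst, hs_open, hi⟩ := mem_nhds_iff.1 ht
    have closed : IsClosed (OnePoint.map u '' sᶜ) :=
      (hs_open.isClosed_compl.isCompact.image (OnePoint.continuous_map hu hp)).isClosed
    refine mem_of_superset (closed.isOpen_compl.mem_nhds ?_) fun y hy => ?_
    · rintro ⟨x, hx, he⟩
      induction x using OnePoint.rec with
      | infty => exact hx hi
      | coe x => exact OnePoint.coe_ne_infty _ he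
    · obtain ⟨x, rfl⟩ : ∃ x, OnePoint.map u x = y := by
        induction y using OnePoint.rec with
        | infty => exact ⟨OnePoint.infty, rfl⟩
        | coe y => exact (hs y).imp' OnePoint.some fun x hx => congrArg OnePoint.some hx
      by_contra hxt
      exact hy ⟨x, fun hxs => hxt (hst hxs), rfl⟩
  | coe x =>
    rw [OnePoint.map_some, OnePoint.nhds_coe_eq, OnePoint.nhds_coe_eq, map_map,
      show OnePoint.map u ∘ (↑) = ((↑) : Y → OnePoint Y) ∘ u from rfl, ← map_map]
    exact map_mono (ho.nhds_le x)

/-- The function `x ↦ 1 / (x - a)` on the sphere, with value `0` at `∞`; the value at `a` is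
junk. -/
def invSub (a : ℂ) (x : P1) : ℂ := x.elim 0 fun z => (z - a)⁻¹

theorem invSub_infty (a : ℂ) : invSub a OnePoint.infty = 0 := rfl

theorem invSub_coe (a z : ℂ) : invSub a (z : P1) = (z - a)⁻¹ := rfl

theorem continuousAt_invSub {a : ℂ} {x : P1} (hx : x ≠ a) : ContinuousAt (invSub a) x := by
  induction x using OnePoint.rec with
  | infty =>
    rw [OnePoint.continuousAt_infty', coclosedCompact_complex, invSub_infty]
    exact tendsto_inv₀_cobounded.comp (tendsto_sub_const_cobounded a)
  | coe z =>
    rw [OnePoint.continuousAt_coe]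
    exact (continuousAt_id.sub continuousAt_const).inv₀ (sub_ne_zero.2 fun h => hx (by simp_all))

theorem continuous_invSub_comp {X : Type*} [TopologicalSpace X] {a : ℂ} {u : X → P1}
    (hu : Continuous u) (h : ∀ x, u x ≠ a) : Continuous fun x => invSub a (u x) :=
  continuous_iff_continuousAt.2 fun x =>
    (continuousAt_invSub (h x)).comp (f := u) hu.continuousAt

/-- The function `x ↦ (x - w) / (x - a)` on the sphere, with value `1` at `∞`, written so that its
joint continuity in `w` and `x` is apparent; the value at `a` is junk. -/
def diffRatio (w a : ℂ) (x : P1) : ℂ := 1 + (a - w) * invSub a x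

theorem diffRatio_infty (w a : ℂ) : diffRatio w a OnePoint.infty = 1 := by
  simp [diffRatio, invSub_infty]

theorem diffRatio_coe {w a z : ℂ} (hz : z ≠ a) : diffRatio w a z = (z - w) / (z - a) := by
  have hza : z - a ≠ 0 := sub_ne_zero.2 hz
  rw [diffRatio, invSub_coe]
  field_simp
  ring

theorem diffRatio_ne_zero {w a : ℂ} {x : P1} (hw : x ≠ w) (ha : x ≠ a) :
    diffRatio w a x ≠ 0 := by
  induction x using OnePoint.rec with
  | infty => simp [diffRatio_infty]
  | coe z =>
    rw [Ne, OnePoint.coe_eq_coe] at hw ha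
    rw [diffRatio_coe ha]
    exact div_ne_zero (sub_ne_zero.2 hw) (sub_ne_zero.2 ha)

/-! ### Loops and the components of their complement -/

section Winding

variable {Y : Type*} [TopologicalSpace Y] {y₀ y₁ : Y} {c : Y → ℂ}

theorem hasLogVariation_diffRatio_iff {z : ℂ} (hz : ∀ y, c y ≠ z) :
    HasLogVariation y₀ y₁ (fun y => diffRatio (c y) (c y₀) z) 0 ↔
      HasLogVariation y₀ y₁ (fun y => c y - z) 0 := by
  have hz0 : z - c y₀ ≠ 0 := sub_ne_zero.2 (hz y₀).symm
  have ratio : ∀ y, diffRatio (c y) (c y₀) z * (c y₀ - z) = c y - z := fun y => by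
    rw [diffRatio_coe (hz y₀).symm]
    field_simp
    ring
  have hconst : HasLogVariation y₀ y₁ (fun _ => c y₀ - z) 0 := .const (sub_ne_zero.2 (hz y₀))
  refine ⟨fun h => ?_, fun h => ?_⟩
  · simpa using (h.mul hconst).congr ratio
  · simpa using (h.mul hconst.inv).congr fun y => by
      rw [← ratio y, mul_inv_cancel_right₀ (sub_ne_zero.2 (hz y₀))]

variable [CompactSpace Y] {K : Set P1}

theorem hasLogVariation_diffRatio_of_mem (hK : IsPreconnected K) (hc : Continuous c)
    (h : c y₁ = c y₀) (hcK : ∀ y, (c y : P1) ∉ K) {x x' : P1} (hx : x ∈ K) (hx' : x' ∈ K)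
    (hl : HasLogVariation y₀ y₁ (fun y => diffRatio (c y) (c y₀) x) 0) :
    HasLogVariation y₀ y₁ (fun y => diffRatio (c y) (c y₀) x') 0 := by
  have : PreconnectedSpace K := Subtype.preconnectedSpace hK
  have ne : ∀ (x : K) y, (x : P1) ≠ c y := fun x y hxy => hcK y (hxy ▸ x.2)
  refine HasLogVariation.of_family (G := fun (x : K) y => diffRatio (c y) (c y₀) x) (k := 1)
    ?_ (fun x y => diffRatio_ne_zero (ne x y) (ne x y₀)) (fun x => by simp [h])
    ⟨x, hx⟩ ⟨x', hx'⟩ hl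
  exact continuous_const.add ((continuous_const.sub (hc.comp continuous_snd)).mul
    (continuous_invSub_comp (continuous_subtype_val.comp continuous_fst) fun q => ne q.1 y₀))

theorem hasLogVariation_sub_of_mem (hK : IsPreconnected K) (hc : Continuous c)
    (h : c y₁ = c y₀) (hcK : ∀ y, (c y : P1) ∉ K) {p q : ℂ} (hp : (p : P1) ∈ K)
    (hq : (q : P1) ∈ K) (hl : HasLogVariation y₀ y₁ (fun y => c y - p) 0) :
    HasLogVariation y₀ y₁ (fun y => c y - q) 0 := by
  rw [← hasLogVariation_diffRatio_iff fun y (e : c y = p) => hcK y (e ▸ hp)] at hl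
  rw [← hasLogVariation_diffRatio_iff fun y (e : c y = q) => hcK y (e ▸ hq)]
  exact hasLogVariation_diffRatio_of_mem hK hc h hcK hp hq hl

theorem hasLogVariation_sub_of_infty_mem (hK : IsPreconnected K) (hc : Continuous c)
    (h : c y₁ = c y₀) (hcK : ∀ y, (c y : P1) ∉ K) (hi : OnePoint.infty ∈ K) {q : ℂ}
    (hq : (q : P1) ∈ K) : HasLogVariation y₀ y₁ (fun y => c y - q) 0 := by
  rw [← hasLogVariation_diffRatio_iff fun y (e : c y = q) => hcK y (e ▸ hq)]
  exact hasLogVariation_diffRatio_of_mem hK hc h hcK hi hq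
    ((HasLogVariation.const one_ne_zero).congr fun y => (diffRatio_infty _ _).symm)

end Winding

theorem WindsAround.of_mem {c : Circle → ℂ} {K : Set P1} (hK : IsPreconnected K)
    (hc : Continuous c) (hcK : ∀ t, (c t : P1) ∉ K) {p q : ℂ} (hp : (p : P1) ∈ K)
    (hq : (q : P1) ∈ K) (h : WindsAround c p) : WindsAround c q :=
  fun hl => h (hasLogVariation_sub_of_mem hK hc rfl hcK hq hp hl)

theorem not_windsAround_of_infty_mem {c : Circle → ℂ} {K : Set P1} (hK : IsPreconnected K)
    (hc : Continuous c) (hcK : ∀ t, (c t : P1) ∉ K) (hi : OnePoint.infty ∈ K) {q : ℂ}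
    (hq : (q : P1) ∈ K) : ¬ WindsAround c q :=
  not_not.2 (hasLogVariation_sub_of_infty_mem hK hc rfl hcK hi hq)

/-! ### Preimages of connected sets -/

section Preimage

variable {X Z : Type*} [TopologicalSpace X] [CompactSpace X] [LocallyConnectedSpace X]
  [TopologicalSpace Z] [T2Space Z] {F : X → Z} {V : Set Z}

theorem subset_image_connectedComponentIn_preimage (hF : Continuous F) (ho : IsOpenMap F)
    (hV : IsOpen V) (hVc : IsPreconnected V) {x : X} (hx : F x ∈ V) :
    V ⊆ F '' connectedComponentIn (F ⁻¹' V) x := by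
  set W := connectedComponentIn (F ⁻¹' V) x
  have hWV : W ⊆ F ⁻¹' V := connectedComponentIn_subset _ _
  have hxW : x ∈ W := mem_connectedComponentIn hx
  have closed_in_preimage : closure W ∩ F ⁻¹' V ⊆ W :=
    (isPreconnected_connectedComponentIn.subset_closure (subset_inter subset_closure hWV)
      inter_subset_left).subset_connectedComponentIn ⟨subset_closure hxW, hx⟩ inter_subset_right
  have closed_image : IsClosed (F '' closure W) := (isClosed_closure.isCompact.image hF).isClosed
  refine hVc.subset_left_of_subset_union (ho _ (hV.preimage hF).connectedComponentIn)
    closed_image.isOpen_compl (disjoint_compl_right.mono_left (image_mono subset_closure)) ?_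
    ⟨F x, hx, x, hxW, rfl⟩
  rintro y hy
  by_cases h : y ∈ F '' closure W
  · obtain ⟨w, hw, rfl⟩ := h
    exact Or.inl ⟨w, closed_in_preimage ⟨hw, hy⟩, rfl⟩
  · exact Or.inr h

theorem isPreconnected_preimage_of_unique (hF : Continuous F) (ho : IsOpenMap F) (hV : IsOpen V)
    (hVc : IsPreconnected V) {x₀ : X} (hx₀ : F x₀ ∈ V) (h : ∀ x, F x = F x₀ → x = x₀) :
    IsPreconnected (F ⁻¹' V) := by
  have single : F ⁻¹' V ⊆ connectedComponentIn (F ⁻¹' V) x₀ := by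
    intro x hx
    obtain ⟨w, hw, hwx⟩ := subset_image_connectedComponentIn_preimage hF ho hV hVc hx hx₀
    rw [h w hwx] at hw
    rw [← connectedComponentIn_eq hw]
    exact mem_connectedComponentIn hx
  rw [single.antisymm (connectedComponentIn_subset _ _)]
  exact isPreconnected_connectedComponentIn

end Preimage

/-! ### Quadratic maps -/

/-- The quadratic polynomial `b (z - k)²` as a map of the sphere; its critical points are `k`
and `∞`. -/
def quadratic (b k : ℂ) : P1 → P1 := OnePoint.map fun z : ℂ => b * (z - k) ^ 2

theorem quadratic_coe (b k z : ℂ) : quadratic b k (z : P1) = ((b * (z - k) ^ 2 : ℂ) : P1) := rfl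

theorem quadratic_infty (b k : ℂ) : quadratic b k OnePoint.infty = OnePoint.infty := rfl

section Quadratic

variable {b k : ℂ} (hb : b ≠ 0)

include hb

theorem tendsto_quadratic :
    Tendsto (fun z : ℂ => b * (z - k) ^ 2) (coclosedCompact ℂ) (coclosedCompact ℂ) := by
  rw [coclosedCompact_complex]
  exact (Filter.tendsto_mul_left_cobounded hb).comp
    ((tendsto_pow_cobounded_cobounded two_ne_zero).comp (tendsto_sub_const_cobounded k))

theorem continuous_quadratic : Continuous (quadratic b k) :=
  OnePoint.continuous_map (by fun_prop) (tendsto_quadratic hb)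

theorem surjective_mul_sub_sq : Function.Surjective fun z : ℂ => b * (z - k) ^ 2 := fun w => by
  obtain ⟨r, hr⟩ := IsAlgClosed.exists_pow_nat_eq (w / b) two_pos
  exact ⟨k + r, by simp only [add_sub_cancel_left, hr, mul_div_cancel₀ w hb]⟩

theorem isOpenMap_mul_sub_sq : IsOpenMap fun z : ℂ => b * (z - k) ^ 2 := by
  have analytic : AnalyticOnNhd ℂ (fun z : ℂ => b * (z - k) ^ 2) univ :=
    (by fun_prop : Differentiable ℂ fun z : ℂ => b * (z - k) ^ 2).differentiableOn.analyticOnNhd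
      isOpen_univ
  rcases analytic.is_constant_or_isOpen isPreconnected_univ with ⟨w, hw⟩ | h
  · simpa [hb] using (hw (k + 1) trivial).trans (hw k trivial).symm
  · exact fun s hs => h s (subset_univ s) hs

theorem isOpenMap_quadratic : IsOpenMap (quadratic b k) :=
  isOpenMap_onePointMap (by fun_prop) (isOpenMap_mul_sub_sq hb) (surjective_mul_sub_sq hb)
    (tendsto_quadratic hb)

/-- Two points of `S` with the same image are joined by a path whose image is a loop that does not
wind around `0`, so `log (z - k)` has no variation along the path. -/
theorem injOn_quadratic {S L : Set P1} (hS : IsPathConnected S) (hL : IsPreconnected L)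
    (h0 : ((0 : ℂ) : P1) ∈ L) (hi : OnePoint.infty ∈ L) (hSL : ∀ x ∈ S, quadratic b k x ∉ L) :
    InjOn (quadratic b k) S := by
  intro x hx y hy hxy
  obtain ⟨γ, hγ⟩ := hS.joinedIn x hx y hy
  have avoids : ∀ t, quadratic b k (γ t) ∉ L := fun t => hSL _ (hγ t)
  obtain ⟨z, hz, hzγ⟩ := exists_continuous_coe_eq γ.continuous fun t ht =>
    avoids t (by rwa [ht, quadratic_infty])
  have avoids_coe : ∀ t, ((b * (z t - k) ^ 2 : ℂ) : P1) ∉ L := fun t => by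
    rw [← quadratic_coe, hzγ]
    exact avoids t
  have loop : b * (z 1 - k) ^ 2 = b * (z 0 - k) ^ 2 := OnePoint.coe_injective (by
    rw [← quadratic_coe, ← quadratic_coe, hzγ, hzγ, γ.source, γ.target, hxy])
  have variation_zero := hasLogVariation_sub_of_infty_mem (y₀ := (0 : unitInterval)) (y₁ := 1)
    hL (by fun_prop) loop avoids_coe hi h0
  obtain ⟨m, hm, hme⟩ := exists_continuous_log_unitInterval
    (by fun_prop : Continuous fun t => z t - k)
    fun t h => avoids_coe t (by simpa [h] using h0)
  have variation : HasLogVariation (0 : unitInterval) 1 (fun t => z t - k) (m 1 - m 0) :=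
    ⟨m, hm, hme, rfl⟩
  have twice := (((HasLogVariation.const hb).mul (variation.mul variation)).congr
    fun t => by ring).unique variation_zero
  have ends : z 0 - k = z 1 - k := by
    rw [← hme, ← hme, show m 0 = m 1 by linear_combination -twice / 2]
  calc x = z 0 := γ.source.symm.trans (hzγ 0).symm
    _ = z 1 := congrArg _ (sub_left_injective ends)
    _ = y := (hzγ 1).trans γ.target

end Quadratic

theorem exists_quadratic_eq_of_mem_nhds {b k : ℂ} {V : Set P1}
    (hV : V ∈ 𝓝 (k : P1) ∨ V ∈ 𝓝 (OnePoint.infty : P1)) :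
    ∃ x ∈ V, ∃ y ∈ V, x ≠ y ∧ quadratic b k x = quadratic b k y := by
  obtain ⟨z, hz, hadd, hsub⟩ :
      ∃ z : ℂ, z ≠ 0 ∧ ((k + z : ℂ) : P1) ∈ V ∧ ((k - z : ℂ) : P1) ∈ V := by
    rcases hV with hV | hV
    · rw [OnePoint.nhds_coe_eq, mem_map] at hV
      have tendsto_add : Tendsto (fun z : ℂ => k + z) (𝓝[≠] 0) (𝓝 k) :=
        ((by fun_prop : Continuous fun z : ℂ => k + z).tendsto' 0 k (by simp)).mono_left
          nhdsWithin_le_nhds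
      have sub : Tendsto (fun z : ℂ => k - z) (𝓝[≠] 0) (𝓝 k) :=
        ((by fun_prop : Continuous fun z : ℂ => k - z).tendsto' 0 k (by simp)).mono_left
          nhdsWithin_le_nhds
      exact ((eventually_mem_nhdsWithin (s := {0}ᶜ)).and
        ((tendsto_add.eventually hV).and (sub.eventually hV))).exists
    · have hV' : ∀ᶠ z : ℂ in Bornology.cobounded ℂ, (z : P1) ∈ V := by
        rw [← coclosedCompact_complex]
        exact OnePoint.tendsto_coe_infty hV
      exact ((Bornology.eventually_ne_cobounded (0 : ℂ)).and
        (((tendsto_const_add_cobounded k).eventually hV').and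
          ((tendsto_const_sub_cobounded k).eventually hV'))).exists
  refine ⟨_, hadd, _, hsub, fun h => hz ?_, ?_⟩
  · linear_combination OnePoint.coe_injective h / 2
  · rw [quadratic_coe, quadratic_coe]
    congr 1
    ring

/-! ### The quartic and its postcritical set -/

/-- The constant `(1 + i) / 2` of the quartic, which is `2i (z - κ)²` composed with `z²`. -/
def kappa : ℂ := (1 + Complex.I) / 2

theorem two_mul_I_ne_zero : (2 * Complex.I : ℂ) ≠ 0 := mul_ne_zero two_ne_zero Complex.I_ne_zero

theorem two_mul_kappa_sq : 2 * kappa ^ 2 = Complex.I := by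
  unfold kappa
  linear_combination Complex.I_sq / 2

theorem quartic_eq_comp : quartic = quadratic (2 * Complex.I) kappa ∘ quadratic 1 0 := by
  funext x
  induction x using OnePoint.rec with
  | infty => rfl
  | coe z => simp [quartic, quadratic_coe, kappa]

theorem quartic_eq (x : P1) : quartic x = quadratic (2 * Complex.I) kappa (quadratic 1 0 x) :=
  congrFun quartic_eq_comp x

theorem quartic_coe (z : ℂ) :
    quartic (z : P1) = ((2 * Complex.I * (z ^ 2 - kappa) ^ 2 : ℂ) : P1) := rfl

theorem quartic_infty : quartic OnePoint.infty = OnePoint.infty := rfl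

theorem quartic_zero : quartic ((0 : ℂ) : P1) = ((-1 : ℂ) : P1) := by
  rw [quartic_coe]
  congr 1
  linear_combination Complex.I * two_mul_kappa_sq + Complex.I_sq

theorem quartic_one : quartic ((1 : ℂ) : P1) = ((1 : ℂ) : P1) := by
  rw [quartic_coe]
  congr 1
  unfold kappa
  linear_combination (Complex.I / 2 - 1) * Complex.I_sq

theorem quartic_neg_one : quartic ((-1 : ℂ) : P1) = ((1 : ℂ) : P1) := by
  rw [← quartic_one, quartic_coe, quartic_coe, neg_one_sq, one_pow]

theorem continuous_quartic : Continuous quartic := by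
  rw [quartic_eq_comp]
  exact (continuous_quadratic two_mul_I_ne_zero).comp (continuous_quadratic one_ne_zero)

theorem isOpenMap_quartic : IsOpenMap quartic := by
  rw [quartic_eq_comp]
  exact (isOpenMap_quadratic two_mul_I_ne_zero).comp (isOpenMap_quadratic one_ne_zero)

theorem mem_criticalPoints_quartic_of_quadratic_eq {x : P1} (h : quadratic 1 0 x = kappa) :
    x ∈ criticalPoints quartic := by
  rintro ⟨U, hU, hinj⟩
  have hV : quadratic 1 0 '' U ∈ 𝓝 (kappa : P1) :=
    h ▸ (isOpenMap_quadratic one_ne_zero).image_mem_nhds hU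
  obtain ⟨_, ⟨y, hy, rfl⟩, _, ⟨z, hz, rfl⟩, hne, he⟩ :=
    exists_quadratic_eq_of_mem_nhds (b := 2 * Complex.I) (Or.inl hV)
  exact hne (congrArg _ (hinj hy hz (by rwa [quartic_eq, quartic_eq])))

theorem mem_criticalPoints_quartic {x : P1} (h : x = ((0 : ℂ) : P1) ∨ x = OnePoint.infty) :
    x ∈ criticalPoints quartic := by
  rintro ⟨U, hU, hinj⟩
  obtain ⟨y, hy, z, hz, hne, he⟩ := exists_quadratic_eq_of_mem_nhds (b := 1) (k := 0) (V := U)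
    (by rcases h with rfl | rfl <;> simp [hU])
  exact hne (hinj hy hz (by rw [quartic_eq, quartic_eq, he]))

theorem notMem_criticalPoints_coe {u : ℂ → ℂ} {u' z : ℂ} (hu : HasStrictDerivAt u u' z)
    (h : u' ≠ 0) : (z : P1) ∉ criticalPoints (OnePoint.map u) := by
  let e := (hu.hasStrictFDerivAt_equiv h).toOpenPartialHomeomorph u
  refine not_not.2 ⟨(↑) '' e.source, ?_, ?_⟩
  · exact OnePoint.isOpenEmbedding_coe.isOpenMap.image_mem_nhds (e.open_source.mem_nhds
      (hu.hasStrictFDerivAt_equiv h).mem_toOpenPartialHomeomorph_source)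
  · rintro _ ⟨x, hx, rfl⟩ _ ⟨y, hy, rfl⟩ hxy
    rw [e.injOn hx hy (OnePoint.coe_injective hxy)]

theorem notMem_criticalPoints_quartic {z : ℂ} (h0 : z ≠ 0) (hk : z ^ 2 ≠ kappa) :
    (z : P1) ∉ criticalPoints quartic := by
  have hd : HasStrictDerivAt (fun z : ℂ => 2 * Complex.I * (z ^ 2 - kappa) ^ 2)
      (2 * Complex.I * (2 * (z ^ 2 - kappa) * (2 * z))) z := by
    have inner : HasStrictDerivAt (fun z : ℂ => z ^ 2 - kappa) (2 * z) z := by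
      have sq : HasStrictDerivAt (fun z : ℂ => z ^ 2) (2 * z) z := by
        simpa using hasStrictDerivAt_pow 2 z
      exact sq.sub_const kappa
    simpa using (inner.fun_pow 2).const_mul (2 * Complex.I)
  exact notMem_criticalPoints_coe hd (mul_ne_zero two_mul_I_ne_zero
    (mul_ne_zero (mul_ne_zero two_ne_zero (sub_ne_zero.2 hk)) (mul_ne_zero two_ne_zero h0)))

/-- The finite postcritical points of the quartic; see `Pf_eq`. -/
def finitePf : Set ℂ := {0, 1, -1}

theorem Pf_subset : Pf ⊆ insert OnePoint.infty ((↑) '' finitePf) := by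
  refine iUnion_subset fun n => ?_
  rintro _ ⟨x, hx, rfl⟩
  induction n with
  | zero =>
    induction x using OnePoint.rec with
    | infty => simp [quartic_infty]
    | coe z =>
      by_cases h0 : z = 0
      · simp [h0, quartic_zero, finitePf]
      · by_cases hk : z ^ 2 = kappa
        · simp [quartic_coe, hk, finitePf]
        · exact absurd hx (notMem_criticalPoints_quartic h0 hk)
  | succ n ih =>
    rw [Function.iterate_succ_apply']
    generalize quartic^[n + 1] x = y at ih
    rcases ih with rfl | ⟨_, rfl | rfl | rfl, rfl⟩ <;>
      simp [quartic_infty, quartic_zero, quartic_one, quartic_neg_one, finitePf]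

theorem Pf_eq : Pf = insert OnePoint.infty ((↑) '' finitePf) := by
  refine Pf_subset.antisymm ?_
  rintro _ (rfl | ⟨_, rfl | rfl | rfl, rfl⟩)
  · exact mem_iUnion.2 ⟨0, _, mem_criticalPoints_quartic (Or.inr rfl), by simp [quartic_infty]⟩
  · obtain ⟨r, hr⟩ := IsAlgClosed.exists_pow_nat_eq kappa two_pos
    refine mem_iUnion.2 ⟨0, r, mem_criticalPoints_quartic_of_quadratic_eq ?_, ?_⟩
    · simp [quadratic_coe, hr]
    · simp [quartic_coe, hr]
  · exact mem_iUnion.2 ⟨1, _, mem_criticalPoints_quartic (Or.inl rfl),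
      by simp [quartic_zero, quartic_neg_one]⟩
  · exact mem_iUnion.2 ⟨0, _, mem_criticalPoints_quartic (Or.inl rfl), by simp [quartic_zero]⟩

theorem infty_mem_Pf : OnePoint.infty ∈ Pf := Pf_eq ▸ mem_insert _ _

theorem coe_mem_Pf {z : ℂ} : (z : P1) ∈ Pf ↔ z ∈ finitePf := by
  simp [Pf_eq]

theorem zero_mem_finitePf : (0 : ℂ) ∈ finitePf := Or.inl rfl

theorem one_mem_finitePf : (1 : ℂ) ∈ finitePf := Or.inr (Or.inl rfl)

theorem neg_one_mem_finitePf : (-1 : ℂ) ∈ finitePf := Or.inr (Or.inr rfl)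

/-! ### The sides of a Jordan curve -/

open scoped ENNReal

/-- The modulus `‖z‖` on the sphere, with value `⊤` at `∞`. -/
def modulus (x : P1) : ℝ≥0∞ := x.elim ⊤ fun z => ‖z‖ₑ

theorem modulus_infty : modulus OnePoint.infty = ⊤ := rfl

theorem modulus_coe (z : ℂ) : modulus (z : P1) = ‖z‖ₑ := rfl

theorem modulus_coe_lt_one {z : ℂ} : modulus (z : P1) < 1 ↔ ‖z‖ < 1 := by
  rw [modulus_coe, ← ofReal_norm, ENNReal.ofReal_lt_one]

theorem one_lt_modulus_coe {z : ℂ} : 1 < modulus (z : P1) ↔ 1 < ‖z‖ := by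
  rw [modulus_coe, ← ofReal_norm, ENNReal.one_lt_ofReal]

theorem continuous_modulus : Continuous modulus := by
  refine (OnePoint.continuous_iff _).2 ⟨?_, continuous_enorm⟩
  rw [coclosedCompact_complex]
  exact (ENNReal.tendsto_ofReal_atTop.comp tendsto_norm_cobounded_atTop).congr ofReal_norm

theorem modulus_sphereInv (x : P1) : modulus (sphereInv x) = (modulus x)⁻¹ := by
  induction x using OnePoint.rec with
  | infty => simp [sphereInv_infty, modulus_coe, modulus_infty]
  | coe z =>
    obtain rfl | hz := eq_or_ne z 0
    · simp [sphereInv_zero, modulus_coe, modulus_infty]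
    · rw [sphereInv_coe hz, modulus_coe, modulus_coe, enorm_inv hz]

theorem exists_modulus_eq (r : ℝ≥0∞) : ∃ x, modulus x = r := by
  obtain rfl | hr := eq_or_ne r ⊤
  · exact ⟨OnePoint.infty, rfl⟩
  · exact ⟨(r.toReal : ℂ), by simp [modulus_coe, hr, ← ofReal_norm]⟩

theorem isPreconnected_modulus_lt (r : ℝ≥0∞) : IsPreconnected {x | modulus x < r} := by
  have image : {x | modulus x < r} = (↑) '' Metric.eball (0 : ℂ) r := by
    ext x
    induction x using OnePoint.rec with
    | infty => simp [modulus_infty]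
    | coe z => simp [modulus_coe]
  rw [image]
  exact ((convex_eball _ _).isPreconnected).image _ OnePoint.continuous_coe.continuousOn

/-- The image under `Φ` of the open disc of radius `r` about `0`. -/
def innerDomain (Φ : P1 ≃ₜ P1) (r : ℝ≥0∞) : Set P1 := {x | modulus (Φ.symm x) < r}

/-- The image under `Φ` of the exterior in the sphere of the closed disc of radius `r` about `0`. -/
def outerDomain (Φ : P1 ≃ₜ P1) (r : ℝ≥0∞) : Set P1 := {x | r < modulus (Φ.symm x)}

/-- The image under `Φ` of the unit circle. -/
def jordanCurve (Φ : P1 ≃ₜ P1) : Set P1 := {x | modulus (Φ.symm x) = 1}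

section Domains

variable {Φ : P1 ≃ₜ P1} {r r' : ℝ≥0∞} {x : P1}

theorem jordanCurve_eq_image (Φ : P1 ≃ₜ P1) :
    jordanCurve Φ = Φ '' ((fun z : ℂ => (z : P1)) '' Metric.sphere (0 : ℂ) 1) := by
  rw [Φ.image_eq_preimage_symm]
  ext x
  rw [mem_preimage]
  change modulus (Φ.symm x) = 1 ↔ _
  induction Φ.symm x using OnePoint.rec with
  | infty => simp [modulus_infty]
  | coe z => simp [modulus_coe, ← ofReal_norm]

theorem continuous_modulus_symm (Φ : P1 ≃ₜ P1) : Continuous fun x => modulus (Φ.symm x) :=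
  continuous_modulus.comp Φ.symm.continuous

theorem isOpen_innerDomain : IsOpen (innerDomain Φ r) :=
  isOpen_lt (continuous_modulus_symm Φ) continuous_const

theorem isOpen_outerDomain : IsOpen (outerDomain Φ r) :=
  isOpen_lt continuous_const (continuous_modulus_symm Φ)

theorem isPreconnected_innerDomain : IsPreconnected (innerDomain Φ r) := by
  have image : Φ '' {x | modulus x < r} = innerDomain Φ r := Φ.image_eq_preimage_symm _
  exact image ▸ (isPreconnected_modulus_lt r).image _ Φ.continuous.continuousOn

theorem innerDomain_sphereInvHomeo_trans :
    innerDomain (sphereInvHomeo.trans Φ) r = outerDomain Φ r⁻¹ :=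
  ext fun x => by
    change modulus (sphereInv (Φ.symm x)) < r ↔ r⁻¹ < modulus (Φ.symm x)
    rw [modulus_sphereInv, ENNReal.inv_lt_iff_inv_lt]

theorem jordanCurve_sphereInvHomeo_trans :
    jordanCurve (sphereInvHomeo.trans Φ) = jordanCurve Φ :=
  ext fun x => by
    change modulus (sphereInv (Φ.symm x)) = 1 ↔ modulus (Φ.symm x) = 1
    rw [modulus_sphereInv, ENNReal.inv_eq_one]

theorem outerDomain_sphereInvHomeo_trans :
    outerDomain (sphereInvHomeo.trans Φ) r = innerDomain Φ r⁻¹ :=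
  ext fun x => by
    change r < modulus (sphereInv (Φ.symm x)) ↔ modulus (Φ.symm x) < r⁻¹
    rw [modulus_sphereInv, ENNReal.lt_inv_iff_lt_inv]

theorem isPreconnected_outerDomain : IsPreconnected (outerDomain Φ r) := by
  rw [← inv_inv r, ← innerDomain_sphereInvHomeo_trans]
  exact isPreconnected_innerDomain

theorem disjoint_innerDomain_outerDomain (h : r ≤ r') :
    Disjoint (innerDomain Φ r) (outerDomain Φ r') :=
  disjoint_left.2 fun _ hx hx' => (hx.trans_le h).not_gt hx'

theorem nonempty_innerDomain_inter_outerDomain (h : r < r') :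
    (innerDomain Φ r' ∩ outerDomain Φ r).Nonempty := by
  obtain ⟨s, hrs, hsr⟩ := exists_between h
  obtain ⟨x, rfl⟩ := exists_modulus_eq s
  exact ⟨Φ x, by simpa [innerDomain] using hsr, by simpa [outerDomain] using hrs⟩

theorem mem_innerDomain_or_mem_outerDomain (h : x ∉ jordanCurve Φ) :
    x ∈ innerDomain Φ 1 ∨ x ∈ outerDomain Φ 1 :=
  lt_or_gt_of_ne h

theorem connectedComponentIn_subset_innerDomain (hx : x ∈ innerDomain Φ 1) :
    connectedComponentIn (jordanCurve Φ)ᶜ x ⊆ innerDomain Φ 1 :=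
  isPreconnected_connectedComponentIn.subset_left_of_subset_union isOpen_innerDomain
    isOpen_outerDomain (disjoint_innerDomain_outerDomain le_rfl)
    (fun _ hy => mem_innerDomain_or_mem_outerDomain (connectedComponentIn_subset _ _ hy))
    ⟨x, mem_connectedComponentIn (ne_of_lt hx), hx⟩

theorem connectedComponentIn_subset_outerDomain (hx : x ∈ outerDomain Φ 1) :
    connectedComponentIn (jordanCurve Φ)ᶜ x ⊆ outerDomain Φ 1 :=
  isPreconnected_connectedComponentIn.subset_right_of_subset_union isOpen_innerDomain
    isOpen_outerDomain (disjoint_innerDomain_outerDomain le_rfl)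
    (fun _ hy => mem_innerDomain_or_mem_outerDomain (connectedComponentIn_subset _ _ hy))
    ⟨x, mem_connectedComponentIn (ne_of_gt hx), hx⟩

/-- After composing `Φ` with `1 / z` if necessary, `∞` lies outside. -/
theorem exists_jordanCurve_eq_and_infty_mem_outerDomain (hi : OnePoint.infty ∉ jordanCurve Φ) :
    ∃ Ψ, jordanCurve Ψ = jordanCurve Φ ∧ OnePoint.infty ∈ outerDomain Ψ 1 := by
  obtain h | h := mem_innerDomain_or_mem_outerDomain hi
  · exact ⟨_, jordanCurve_sphereInvHomeo_trans,
      by rwa [outerDomain_sphereInvHomeo_trans, inv_one]⟩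
  · exact ⟨Φ, rfl, h⟩

end Domains

section EssentialCurves

variable {γ : Set P1} {Φ : P1 ≃ₜ P1}

theorem nontrivial_connectedComponentIn_inter {P : Set P1} (h : IsEssentialCurve P γ) {x : P1}
    (hx : x ∉ γ) : (connectedComponentIn γᶜ x ∩ P).Nontrivial :=
  one_lt_encard_iff_nontrivial.1 (Nat.one_lt_ofNat.trans_le (h.2.2 x hx))

theorem nontrivial_innerDomain_inter {P : Set P1} (h : IsEssentialCurve P (jordanCurve Φ)) :
    (innerDomain Φ 1 ∩ P).Nontrivial := by
  obtain ⟨x, hx, -⟩ := nonempty_innerDomain_inter_outerDomain (Φ := Φ) zero_lt_one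
  exact (nontrivial_connectedComponentIn_inter h (ne_of_lt hx)).mono
    (inter_subset_inter_left _ (connectedComponentIn_subset_innerDomain hx))

theorem nontrivial_outerDomain_inter {P : Set P1} (h : IsEssentialCurve P (jordanCurve Φ)) :
    (outerDomain Φ 1 ∩ P).Nontrivial := by
  obtain ⟨x, -, hx⟩ := nonempty_innerDomain_inter_outerDomain (Φ := Φ) ENNReal.one_lt_top
  exact (nontrivial_connectedComponentIn_inter h (ne_of_gt hx)).mono
    (inter_subset_inter_left _ (connectedComponentIn_subset_outerDomain hx))

theorem finitePf_eq_of_ne {p q₁ q₂ : ℂ} (hp : p ∈ finitePf) (h₁ : q₁ ∈ finitePf)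
    (h₂ : q₂ ∈ finitePf) (hp₁ : p ≠ q₁) (hp₂ : p ≠ q₂) (h₁₂ : q₁ ≠ q₂) :
    finitePf = {p, q₁, q₂} := by
  refine (eq_of_subset_of_ncard_le ?_ ?_ (by simp [finitePf])).symm
  · rintro _ (rfl | rfl | rfl) <;> assumption
  · rw [ncard_eq_three.2 ⟨p, q₁, q₂, hp₁, hp₂, h₁₂, rfl⟩, finitePf,
      ncard_eq_three.2 ⟨0, 1, -1, by norm_num, by norm_num, by norm_num, rfl⟩]

theorem exists_coe_mem_of_nontrivial {U : Set P1} (h : (U ∩ Pf).Nontrivial) :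
    ∃ p ∈ finitePf, (p : P1) ∈ U := by
  obtain ⟨x, ⟨hxU, hxP⟩, hx⟩ := h.exists_ne OnePoint.infty
  obtain ⟨p, rfl⟩ := OnePoint.ne_infty_iff_exists.1 hx
  exact ⟨p, coe_mem_Pf.1 hxP, hxU⟩

theorem exists_coe_mem_ne_of_nontrivial {U : Set P1} (hi : OnePoint.infty ∉ U)
    (h : (U ∩ Pf).Nontrivial) :
    ∃ q₁ ∈ finitePf, ∃ q₂ ∈ finitePf, q₁ ≠ q₂ ∧ (q₁ : P1) ∈ U ∧ (q₂ : P1) ∈ U := by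
  obtain ⟨x, ⟨hxU, hxP⟩, y, ⟨hyU, hyP⟩, hxy⟩ := h
  obtain ⟨q₁, rfl⟩ := OnePoint.ne_infty_iff_exists.1 (ne_of_mem_of_not_mem hxU hi)
  obtain ⟨q₂, rfl⟩ := OnePoint.ne_infty_iff_exists.1 (ne_of_mem_of_not_mem hyU hi)
  exact ⟨q₁, coe_mem_Pf.1 hxP, q₂, coe_mem_Pf.1 hyP, fun h => hxy (congrArg _ h), hxU, hyU⟩

theorem exists_domains_of_isEssentialCurve (hγ : IsEssentialCurve Pf γ) :
    ∃ (Φ : P1 ≃ₜ P1) (r : ℝ≥0∞), ∃ p ∈ finitePf, 1 < r ∧ γ = jordanCurve Φ ∧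
      OnePoint.infty ∈ outerDomain Φ r ∧ (p : P1) ∈ outerDomain Φ r ∧
      ∀ q ∈ finitePf, q ≠ p → (q : P1) ∈ innerDomain Φ 1 := by
  obtain ⟨Φ₀, rfl⟩ := hγ.1
  rw [← jordanCurve_eq_image] at hγ
  obtain ⟨Φ, hΦ, hi⟩ := exists_jordanCurve_eq_and_infty_mem_outerDomain
    (disjoint_right.1 hγ.2.1 infty_mem_Pf)
  rw [← hΦ] at hγ
  obtain ⟨p, hp, hpΦ⟩ := exists_coe_mem_of_nontrivial (nontrivial_outerDomain_inter hγ)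
  have disjoint := disjoint_innerDomain_outerDomain (Φ := Φ) (le_refl 1)
  obtain ⟨q₁, h₁, q₂, h₂, h₁₂, hq₁, hq₂⟩ := exists_coe_mem_ne_of_nontrivial
    (disjoint_right.1 disjoint hi) (nontrivial_innerDomain_inter hγ)
  have ne_p : ∀ q : ℂ, (q : P1) ∈ innerDomain Φ 1 → p ≠ q := fun q hq h =>
    disjoint_right.1 disjoint hpΦ (h ▸ hq)
  obtain ⟨r, hr, hr'⟩ := exists_between (lt_min (b := modulus _) (c := modulus _) hi hpΦ)
  refine ⟨Φ, r, p, hp, hr, (hΦ.trans (jordanCurve_eq_image Φ₀)).symm,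
    hr'.trans_le (min_le_left _ _), hr'.trans_le (min_le_right _ _), fun q hq hqp => ?_⟩
  rw [finitePf_eq_of_ne hp h₁ h₂ (ne_p _ hq₁) (ne_p _ hq₂) h₁₂] at hq
  obtain rfl | rfl | rfl := hq
  exacts [absurd rfl hqp, hq₁, hq₂]

end EssentialCurves

/-! ### Winding around the inside of a Jordan curve -/

/-- Otherwise the ratio `(z - a) / (z - w)`, with `w` a finite avoided point outside the closed
disc, would have a logarithm along the unit circle, since it has one along a constant loop. -/
theorem exists_eq_of_nullhomotopy {K : unitInterval → Circle → P1}
    (hK : Continuous fun q : unitInterval × Circle => K q.1 q.2) (h0 : ∀ t, K 0 t = (t : ℂ))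
    (h1 : ∀ t, K 1 t = K 1 1) {a : ℂ} (ha : ‖a‖ < 1) {b : P1} (hb : 1 < modulus b) :
    ∃ s t, K s t = a ∨ K s t = b := by
  by_contra! avoid
  obtain ⟨w, hw, hKw⟩ : ∃ w : ℂ, 1 < ‖w‖ ∧ ∀ s t, K s t ≠ w := by
    have avoided : IsOpen ((range fun q : unitInterval × Circle => K q.1 q.2)ᶜ ∩
        {x | 1 < modulus x}) :=
      (isCompact_range hK).isClosed.isOpen_compl.inter (isOpen_lt continuous_const
        continuous_modulus)
    obtain ⟨w, hw, hw1⟩ := OnePoint.denseRange_coe.exists_mem_open avoided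
      ⟨b, by rintro ⟨q, hq⟩; exact (avoid q.1 q.2).2 hq, hb⟩
    exact ⟨w, one_lt_modulus_coe.1 hw1, fun s t h => hw ⟨(s, t), h⟩⟩
  have ne : ∀ t : Circle, (t : ℂ) ≠ w := fun t h => hw.ne' (h ▸ t.norm_coe)
  have ratio : HasLogVariation (1 : Circle) 1 (fun t => diffRatio a w (K 0 t)) 0 := by
    refine HasLogVariation.of_family (G := fun s t => diffRatio a w (K s t)) (k := 1)
      (continuous_const.add (continuous_const.mul (continuous_invSub_comp hK fun q => hKw _ _)))
      (fun s t => diffRatio_ne_zero (avoid s t).1 (hKw s t)) (by simp) 1 0 ?_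
    exact (HasLogVariation.const (diffRatio_ne_zero (avoid 1 1).1 (hKw 1 1))).congr
      fun t => by rw [h1 t]
  refine windsAround_coe ha (add_zero (0 : ℂ) ▸
    (ratio.mul (not_not.1 (not_windsAround_coe hw))).congr fun t => ?_)
  rw [h0, diffRatio_coe (ne t), div_mul_cancel₀ _ (sub_ne_zero.2 (ne t))]

theorem windsAround_of_mem_innerDomain {Φ : P1 ≃ₜ P1} {d : Circle → ℂ} (hd : Continuous d)
    (hinj : Function.Injective d) (hr : range (fun t => (d t : P1)) = jordanCurve Φ)
    (hi : OnePoint.infty ∈ outerDomain Φ 1) {p : ℂ} (hp : (p : P1) ∈ innerDomain Φ 1) :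
    WindsAround d p := by
  rintro ⟨ℓ, hℓ, he, -⟩
  have hdc : Continuous fun t => (d t : P1) := OnePoint.continuous_coe.comp hd
  have emb : IsEmbedding fun t => (d t : P1) :=
    (hdc.isClosedEmbedding (OnePoint.coe_injective.comp hinj)).isEmbedding
  have mem_range : ∀ t : Circle, Φ (t : ℂ) ∈ range fun t => (d t : P1) := fun t => by
    rw [hr, jordanCurve_eq_image]
    exact ⟨_, ⟨t, by simp [t.norm_coe], rfl⟩, rfl⟩
  choose σ hσ using mem_range
  have hσc : Continuous σ := emb.continuous_iff.2
    ((Φ.continuous.comp (OnePoint.continuous_coe.comp continuous_subtype_val)).congr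
      fun t => (hσ t).symm)
  obtain ⟨a, ha, hap⟩ : ∃ a : ℂ, ‖a‖ < 1 ∧ (a : P1) = Φ.symm p := by
    obtain ⟨a, ha⟩ := OnePoint.ne_infty_iff_exists.1
      (ne_of_apply_ne modulus (hp.trans_le le_top).ne)
    exact ⟨a, modulus_coe_lt_one.1 (ha ▸ hp), ha⟩
  obtain ⟨s, t, h⟩ := exists_eq_of_nullhomotopy
    (K := fun s t => Φ.symm ((p + Complex.exp ((1 - (s : ℝ)) * ℓ (σ t)) : ℂ) : P1))
    (Φ.symm.continuous.comp (OnePoint.continuous_coe.comp (by fun_prop)))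
    (fun t => by simp [he, hσ]) (fun t => by simp) ha hi
  simp [hap] at h

/-! ### Preimages of curves under the quartic -/

theorem isPathConnected_connectedComponentIn {X : Type*} [TopologicalSpace X]
    [LocallyPathConnectedSpace X] {U : Set X} (hU : IsOpen U) {x : X} (hx : x ∈ U) :
    IsPathConnected (connectedComponentIn U x) :=
  hU.connectedComponentIn.isConnected_iff_isPathConnected.1
    (isConnected_connectedComponentIn_iff.2 hx)

theorem eq_infty_of_quadratic_eq_infty {b k : ℂ} {x : P1}
    (h : quadratic b k x = OnePoint.infty) : x = OnePoint.infty := by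
  induction x using OnePoint.rec with
  | infty => rfl
  | coe z => exact absurd h (OnePoint.coe_ne_infty _)

theorem isPreconnected_preimage_quadratic {b k : ℂ} (hb : b ≠ 0) {V : Set P1} (hV : IsOpen V)
    (hVc : IsPreconnected V) (hi : OnePoint.infty ∈ V) : IsPreconnected (quadratic b k ⁻¹' V) :=
  isPreconnected_preimage_of_unique (continuous_quadratic hb) (isOpenMap_quadratic hb) hV hVc
    (x₀ := OnePoint.infty) hi fun _ => eq_infty_of_quadratic_eq_infty

theorem isPreconnected_preimage_quartic {V : Set P1} (hV : IsOpen V) (hVc : IsPreconnected V)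
    (hi : OnePoint.infty ∈ V) : IsPreconnected (quartic ⁻¹' V) := by
  rw [quartic_eq_comp, preimage_comp]
  exact isPreconnected_preimage_quadratic one_ne_zero
    (hV.preimage (continuous_quadratic two_mul_I_ne_zero))
    (isPreconnected_preimage_quadratic two_mul_I_ne_zero hV hVc hi) hi

theorem apply_mem_of_mem_connectedComponentIn_preimage {X Z : Type*} [TopologicalSpace X]
    {F : X → Z} {V : Set Z} {x y : X} (h : y ∈ connectedComponentIn (F ⁻¹' V) x) : F y ∈ V :=
  connectedComponentIn_subset (F ⁻¹' V) x h

/-- The finite postcritical points that the loop `c` winds around. For a simple closed curve in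
`ℙ¹ - P_f` they are those separated from `∞`, and they are invariant under free homotopy. -/
def woundPoints (c : Circle → ℂ) : Set ℂ := {p ∈ finitePf | WindsAround c p}

section Preimage

variable {Φ : P1 ≃ₜ P1} {r s : ℝ≥0∞} {x y : P1}

theorem isPreconnected_component_union_preimage_outerDomain {F : P1 → P1} (hF : Continuous F)
    (ho : IsOpenMap F) (hs : s < r) (hx : F x ∈ innerDomain Φ r)
    (hpre : IsPreconnected (F ⁻¹' outerDomain Φ s)) :
    IsPreconnected (connectedComponentIn (F ⁻¹' innerDomain Φ r) x ∪ F ⁻¹' outerDomain Φ s) := by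
  obtain ⟨y, hyr, hys⟩ := nonempty_innerDomain_inter_outerDomain (Φ := Φ) hs
  obtain ⟨w, hw, rfl⟩ := subset_image_connectedComponentIn_preimage hF ho isOpen_innerDomain
    isPreconnected_innerDomain hx hyr
  exact .union w hw hys isPreconnected_connectedComponentIn hpre

section Loop

variable {c : Circle → ℂ} {p : ℂ}

theorem not_windsAround_of_quartic_mem_outerDomain (hc : Continuous c)
    (hcγ : ∀ t, quartic (c t) ∈ jordanCurve Φ) (hi : OnePoint.infty ∈ outerDomain Φ 1)
    (hp : quartic p ∈ outerDomain Φ 1) : ¬ WindsAround c p :=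
  not_windsAround_of_infty_mem
    (isPreconnected_preimage_quartic isOpen_outerDomain isPreconnected_outerDomain hi) hc
    (fun t ht => (hcγ t).not_gt ht) hi hp

theorem mem_component_of_windsAround (hr : 1 < r) (hc : Continuous c)
    (hcγ : ∀ t, quartic (c t) ∈ jordanCurve Φ) (hi : OnePoint.infty ∈ outerDomain Φ 1)
    (h : WindsAround c p) :
    (p : P1) ∈ connectedComponentIn (quartic ⁻¹' innerDomain Φ r) (c 1) := by
  by_contra hpc
  have hp : quartic p ∈ innerDomain Φ r := by
    by_contra hp
    exact not_windsAround_of_quartic_mem_outerDomain hc hcγ hi (hr.trans_le (not_lt.1 hp)) h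
  refine not_windsAround_of_infty_mem (isPreconnected_component_union_preimage_outerDomain
    continuous_quartic isOpenMap_quartic hr hp (isPreconnected_preimage_quartic
      isOpen_outerDomain isPreconnected_outerDomain hi)) hc (fun t ht => ?_) (Or.inr hi)
    (Or.inl (mem_connectedComponentIn hp)) h
  obtain ht | ht := ht
  · have loop_subset : range (fun t => (c t : P1)) ⊆
        connectedComponentIn (quartic ⁻¹' innerDomain Φ r) (c 1) :=
      (isPreconnected_range (OnePoint.continuous_coe.comp hc)).subset_connectedComponentIn
        (mem_range_self 1) (range_subset_iff.2 fun t => (hcγ t).trans_lt hr)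
    rw [connectedComponentIn_eq (loop_subset ⟨t, rfl⟩), ← connectedComponentIn_eq ht] at hpc
    exact hpc (mem_connectedComponentIn hp)
  · exact (hcγ t).not_gt ht

theorem woundPoints_subset_of_one_mem_outerDomain (hc : Continuous c)
    (hcγ : ∀ t, quartic (c t) ∈ jordanCurve Φ) (hi : OnePoint.infty ∈ outerDomain Φ 1)
    (h1 : ((1 : ℂ) : P1) ∈ outerDomain Φ 1) : woundPoints c ⊆ {0} := by
  rintro p ⟨rfl | rfl | rfl, hw⟩
  · rfl
  · exact absurd hw (not_windsAround_of_quartic_mem_outerDomain hc hcγ hi (by rwa [quartic_one]))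
  · exact absurd hw
      (not_windsAround_of_quartic_mem_outerDomain hc hcγ hi (by rwa [quartic_neg_one]))

end Loop

section Components

theorem isPathConnected_component_preimage {F : P1 → P1} (hF : Continuous F)
    (hx : F x ∈ innerDomain Φ r) :
    IsPathConnected (connectedComponentIn (F ⁻¹' innerDomain Φ r) x) :=
  isPathConnected_connectedComponentIn (isOpen_innerDomain.preimage hF) hx

theorem quadratic_one_zero_of_sq {a b : ℂ} (h : a ^ 2 = b) : quadratic 1 0 (a : P1) = b := by
  rw [quadratic_coe, one_mul, sub_zero, h]

theorem quadratic_two_mul_I_kappa_zero :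
    quadratic (2 * Complex.I) kappa ((0 : ℂ) : P1) = ((-1 : ℂ) : P1) := by
  rw [← quartic_zero, quartic_eq, quadratic_one_zero_of_sq (zero_pow two_ne_zero)]

theorem quadratic_two_mul_I_kappa_one :
    quadratic (2 * Complex.I) kappa ((1 : ℂ) : P1) = ((1 : ℂ) : P1) := by
  rw [← quadratic_one_zero_of_sq (one_pow 2), ← quartic_eq, quartic_one,
    quadratic_one_zero_of_sq (one_pow 2)]

theorem injOn_sq_component_of_neg_one_mem_outerDomain (hx : quartic x ∈ innerDomain Φ r)
    (hi : OnePoint.infty ∈ outerDomain Φ r) (hm : ((-1 : ℂ) : P1) ∈ outerDomain Φ r) :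
    InjOn (quadratic 1 0) (connectedComponentIn (quartic ⁻¹' innerDomain Φ r) x) := by
  refine injOn_quadratic (L := quadratic (2 * Complex.I) kappa ⁻¹' outerDomain Φ r) one_ne_zero
    (isPathConnected_component_preimage continuous_quartic hx)
    (isPreconnected_preimage_quadratic two_mul_I_ne_zero isOpen_outerDomain
      isPreconnected_outerDomain hi) ?_ hi fun y hy hy' => ?_
  · rwa [mem_preimage, quadratic_two_mul_I_kappa_zero]
  · rw [mem_preimage, ← quartic_eq] at hy'
    exact disjoint_left.1 (disjoint_innerDomain_outerDomain le_rfl)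
      (apply_mem_of_mem_connectedComponentIn_preimage hy) hy'

theorem image_sq_component_subset (hs : s ≤ r)
    (hy : y ∈ connectedComponentIn (quartic ⁻¹' innerDomain Φ s) x) :
    quadratic 1 0 '' connectedComponentIn (quartic ⁻¹' innerDomain Φ s) x ⊆
      connectedComponentIn (quadratic (2 * Complex.I) kappa ⁻¹' innerDomain Φ r)
        (quadratic 1 0 y) := by
  refine (isPreconnected_connectedComponentIn.image _
    (continuous_quadratic one_ne_zero).continuousOn).subset_connectedComponentIn
    (mem_image_of_mem _ hy) ?_
  rintro _ ⟨z, hz, rfl⟩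
  rw [mem_preimage, ← quartic_eq]
  exact (apply_mem_of_mem_connectedComponentIn_preimage hz).trans_le hs

/-- The component of `0` in the preimage, together with the preimage of the outside, joins the
critical values `0` and `∞` of the squaring map. -/
theorem injOn_sq_component_of_zero_notMem (hs : s < r) (hx : quartic x ∈ innerDomain Φ s)
    (hi : OnePoint.infty ∈ outerDomain Φ s) (hm : ((-1 : ℂ) : P1) ∈ innerDomain Φ r)
    (h : ((0 : ℂ) : P1) ∉ connectedComponentIn
      (quadratic (2 * Complex.I) kappa ⁻¹' innerDomain Φ r) (quadratic 1 0 x)) :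
    InjOn (quadratic 1 0) (connectedComponentIn (quartic ⁻¹' innerDomain Φ s) x) := by
  rw [← quadratic_two_mul_I_kappa_zero] at hm
  refine injOn_quadratic one_ne_zero (isPathConnected_component_preimage continuous_quartic hx)
    (isPreconnected_component_union_preimage_outerDomain (continuous_quadratic two_mul_I_ne_zero)
      (isOpenMap_quadratic two_mul_I_ne_zero) hs hm (isPreconnected_preimage_quadratic
        two_mul_I_ne_zero isOpen_outerDomain isPreconnected_outerDomain hi))
    (Or.inl (mem_connectedComponentIn hm)) (Or.inr hi) fun y hy hy' => ?_
  obtain hy' | hy' := hy'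
  · have hyx := image_sq_component_subset hs.le (mem_connectedComponentIn hx)
      (mem_image_of_mem _ hy)
    rw [connectedComponentIn_eq hyx, ← connectedComponentIn_eq hy'] at h
    exact h (mem_connectedComponentIn hm)
  · rw [mem_preimage, ← quartic_eq] at hy'
    exact disjoint_left.1 (disjoint_innerDomain_outerDomain le_rfl)
      (apply_mem_of_mem_connectedComponentIn_preimage hy) hy'

theorem zero_mem_component_of_zero_mem_component (hr : s ≤ r)
    (hi : OnePoint.infty ∈ outerDomain Φ r) (h0 : ((0 : ℂ) : P1) ∈ outerDomain Φ r)
    (h1 : ((1 : ℂ) : P1) ∈ innerDomain Φ s) (hm : ((-1 : ℂ) : P1) ∈ innerDomain Φ s)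
    (h : ((0 : ℂ) : P1) ∈ connectedComponentIn
      (quadratic (2 * Complex.I) kappa ⁻¹' innerDomain Φ r) ((1 : ℂ) : P1)) :
    ((0 : ℂ) : P1) ∈ connectedComponentIn
      (quadratic (2 * Complex.I) kappa ⁻¹' innerDomain Φ s) ((1 : ℂ) : P1) := by
  rw [← quadratic_two_mul_I_kappa_one] at h1
  obtain ⟨x, hx, hxm⟩ := subset_image_connectedComponentIn_preimage
    (continuous_quadratic two_mul_I_ne_zero) (isOpenMap_quadratic two_mul_I_ne_zero)
    isOpen_innerDomain isPreconnected_innerDomain h1 hm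
  have inj := injOn_quadratic two_mul_I_ne_zero (isPathConnected_component_preimage
    (continuous_quadratic two_mul_I_ne_zero) (h1.trans_le hr)) isPreconnected_outerDomain h0 hi
    fun y hy hy' => disjoint_left.1 (disjoint_innerDomain_outerDomain le_rfl)
      (apply_mem_of_mem_connectedComponentIn_preimage hy) hy'
  have hsr : innerDomain Φ s ⊆ innerDomain Φ r := fun _ hy => hy.trans_le hr
  have hxr := connectedComponentIn_mono _ (preimage_mono hsr) hx
  rwa [inj h hxr (quadratic_two_mul_I_kappa_zero.trans hxm.symm)]

end Components

section Loop

variable {c : Circle → ℂ}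

theorem subsingleton_woundPoints_of_injOn {Q : Set P1} (hQ : ∀ p, WindsAround c p → (p : P1) ∈ Q)
    (hinj : InjOn (quadratic 1 0) Q)
    (h0 : ∀ p : ℂ, p ^ 2 = 1 → WindsAround c p → ¬ WindsAround c 0) :
    (woundPoints c).Subsingleton := by
  have not_both : WindsAround c 1 → ¬ WindsAround c (-1) := fun h hm => by
    have := OnePoint.coe_injective (hinj (hQ _ h) (hQ _ hm) (by
      rw [quadratic_one_zero_of_sq (one_pow 2), quadratic_one_zero_of_sq neg_one_sq]))
    norm_num at this
  rintro p ⟨rfl | rfl | rfl, hp⟩ q ⟨rfl | rfl | rfl, hq⟩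
  · rfl
  · exact absurd hp (h0 1 (one_pow 2) hq)
  · exact absurd hp (h0 (-1) neg_one_sq hq)
  · exact absurd hq (h0 1 (one_pow 2) hp)
  · rfl
  · exact absurd hq (not_both hp)
  · exact absurd hq (h0 (-1) neg_one_sq hp)
  · exact absurd hp (not_both hq)
  · rfl

theorem subsingleton_woundPoints_of_neg_one_mem_outerDomain (hr : 1 < r) (hc : Continuous c)
    (hcγ : ∀ t, quartic (c t) ∈ jordanCurve Φ) (hi : OnePoint.infty ∈ outerDomain Φ r)
    (hm : ((-1 : ℂ) : P1) ∈ outerDomain Φ r) : (woundPoints c).Subsingleton :=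
  subsingleton_woundPoints_of_injOn
    (fun _ => mem_component_of_windsAround hr hc hcγ (hr.trans hi))
    (injOn_sq_component_of_neg_one_mem_outerDomain ((hcγ 1).trans_lt hr) hi hm)
    fun _ _ _ => not_windsAround_of_quartic_mem_outerDomain hc hcγ (hr.trans hi)
      (by rw [quartic_zero]; exact hr.trans hm)

theorem subsingleton_woundPoints_of_zero_notMem (hr : 1 < r) (hc : Continuous c)
    (hcγ : ∀ t, quartic (c t) ∈ jordanCurve Φ) (hi : OnePoint.infty ∈ outerDomain Φ r)
    (hm : ((-1 : ℂ) : P1) ∈ innerDomain Φ r)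
    (h : ((0 : ℂ) : P1) ∉ connectedComponentIn
      (quadratic (2 * Complex.I) kappa ⁻¹' innerDomain Φ r) ((1 : ℂ) : P1)) :
    (woundPoints c).Subsingleton := by
  obtain ⟨s, h1s, hsr⟩ := exists_between hr
  have mem_Q := fun p : ℂ => mem_component_of_windsAround (p := p) h1s hc hcγ (hr.trans hi)
  have hQ : ∀ {p : ℂ}, p ^ 2 = 1 → WindsAround c p →
      quadratic 1 0 '' connectedComponentIn (quartic ⁻¹' innerDomain Φ s) (c 1) ⊆
        connectedComponentIn (quadratic (2 * Complex.I) kappa ⁻¹' innerDomain Φ r)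
          ((1 : ℂ) : P1) := fun hp hw => by
    simpa only [quadratic_one_zero_of_sq hp] using image_sq_component_subset hsr.le (mem_Q _ hw)
  by_cases! hw : ∃ p : ℂ, p ^ 2 = 1 ∧ WindsAround c p
  · obtain ⟨p, hp, hw⟩ := hw
    refine subsingleton_woundPoints_of_injOn mem_Q ?_ fun q hq hqw h0 =>
      h (hQ hq hqw ⟨_, mem_Q _ h0, quadratic_one_zero_of_sq (zero_pow two_ne_zero)⟩)
    rw [connectedComponentIn_eq (mem_Q p hw)]
    refine injOn_sq_component_of_zero_notMem hsr
      (apply_mem_of_mem_connectedComponentIn_preimage (mem_Q p hw)) (hsr.trans hi) hm ?_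
    rwa [quadratic_one_zero_of_sq hp]
  · refine (subsingleton_singleton (a := (0 : ℂ))).anti ?_
    rintro p ⟨rfl | rfl | rfl, hpw⟩
    exacts [rfl, absurd hpw (hw 1 (one_pow 2)), absurd hpw (hw (-1) neg_one_sq)]

theorem woundPoints_of_zero_mem (hc : Continuous c)
    (hcγ : ∀ t, quartic (c t) ∈ jordanCurve Φ)
    (h1 : ((1 : ℂ) : P1) ∈ innerDomain Φ 1)
    (h : ((0 : ℂ) : P1) ∈ connectedComponentIn
      (quadratic (2 * Complex.I) kappa ⁻¹' innerDomain Φ 1) ((1 : ℂ) : P1)) :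
    finitePf ⊆ woundPoints c ∨ woundPoints c = ∅ := by
  set R := connectedComponentIn
    (quadratic (2 * Complex.I) kappa ⁻¹' innerDomain Φ 1) ((1 : ℂ) : P1)
  have hsq : IsPreconnected (quadratic 1 0 ⁻¹' R) := by
    have sq_zero := quadratic_one_zero_of_sq (zero_pow two_ne_zero)
    refine isPreconnected_preimage_of_unique (x₀ := ((0 : ℂ) : P1))
      (continuous_quadratic one_ne_zero) (isOpenMap_quadratic one_ne_zero)
      (isOpen_innerDomain.preimage (continuous_quadratic two_mul_I_ne_zero)).connectedComponentIn
      isPreconnected_connectedComponentIn (by rwa [sq_zero]) fun x hx => ?_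
    rw [sq_zero] at hx
    induction x using OnePoint.rec with
    | infty => exact absurd hx.symm (OnePoint.coe_ne_infty _)
    | coe z => simpa [quadratic_coe] using hx
  have mem_sq : ∀ p ∈ finitePf, (p : P1) ∈ quadratic 1 0 ⁻¹' R := by
    have h1R : ((1 : ℂ) : P1) ∈ R :=
      mem_connectedComponentIn (by rwa [mem_preimage, quadratic_two_mul_I_kappa_one])
    rintro p (rfl | rfl | rfl)
    · rwa [mem_preimage, quadratic_one_zero_of_sq (zero_pow two_ne_zero)]
    · rwa [mem_preimage, quadratic_one_zero_of_sq (one_pow 2)]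
    · rwa [mem_preimage, quadratic_one_zero_of_sq neg_one_sq]
  have avoids : ∀ t, (c t : P1) ∉ quadratic 1 0 ⁻¹' R := fun t ht => by
    have := connectedComponentIn_subset _ _ ht
    rw [mem_preimage, ← quartic_eq] at this
    exact this.ne (hcγ t)
  refine or_iff_not_imp_right.2 fun hne q hq => ?_
  obtain ⟨p, hp, hpw⟩ := nonempty_iff_ne_empty.2 hne
  exact ⟨hq, hpw.of_mem hsq hc avoids (mem_sq p hp) (mem_sq q hq)⟩

end Loop

end Preimage

theorem woundPoints_of_quartic_mem {γ : Set P1} (hγ : IsEssentialCurve Pf γ) {c : Circle → ℂ}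
    (hc : Continuous c) (hcγ : ∀ t, quartic (c t) ∈ γ) :
    finitePf ⊆ woundPoints c ∨ (woundPoints c).Subsingleton := by
  obtain ⟨Φ, r, p, hp, hr, rfl, hi, hpr, hq⟩ := exists_domains_of_isEssentialCurve hγ
  obtain rfl | rfl | rfl := hp
  · have h1 := hq 1 one_mem_finitePf one_ne_zero
    have hm := hq (-1) neg_one_mem_finitePf (by norm_num)
    by_cases h : ((0 : ℂ) : P1) ∈ connectedComponentIn
      (quadratic (2 * Complex.I) kappa ⁻¹' innerDomain Φ r) ((1 : ℂ) : P1)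
    · exact (woundPoints_of_zero_mem hc hcγ h1
        (zero_mem_component_of_zero_mem_component hr.le hi hpr h1 hm h)).imp_right
        fun he => subsingleton_empty.anti he.subset
    · exact Or.inr (subsingleton_woundPoints_of_zero_notMem hr hc hcγ hi (hm.trans hr) h)
  · exact Or.inr (subsingleton_singleton.anti
      (woundPoints_subset_of_one_mem_outerDomain hc hcγ (hr.trans hi) (hr.trans hpr)))
  · exact Or.inr (subsingleton_woundPoints_of_neg_one_mem_outerDomain hr hc hcγ hi hpr)

theorem woundPoints_of_isEssentialCurve {γ : Set P1} (hγ : IsEssentialCurve Pf γ)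
    {d : Circle → ℂ} (hd : Continuous d) (hinj : Function.Injective d)
    (hdγ : range (fun t => (d t : P1)) = γ) :
    ∃ p ∈ finitePf, woundPoints d = finitePf \ {p} := by
  obtain ⟨Φ, r, p, hp, hr, rfl, hi, hpr, hq⟩ := exists_domains_of_isEssentialCurve hγ
  have hcγ : ∀ t, (d t : P1) ∈ jordanCurve Φ := fun t => hdγ ▸ mem_range_self t
  refine ⟨p, hp, ext fun q => and_congr_right fun hqP => ⟨?_, fun hqp =>
    windsAround_of_mem_innerDomain hd hinj hdγ (hr.trans hi) (hq q hqP hqp)⟩⟩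
  rintro h rfl
  exact not_windsAround_of_infty_mem isPreconnected_outerDomain hd
    (fun t ht => (hcγ t).not_gt ht) (hr.trans hi) (hr.trans hpr) h

theorem exists_planar_homotopy {P : Set P1} (hi : OnePoint.infty ∈ P)
    {c d : C(Circle, (Pᶜ : Set P1))} (h : c.Homotopic d) :
    ∃ K : unitInterval → Circle → ℂ, (Continuous fun q : unitInterval × Circle => K q.1 q.2) ∧
      (∀ s t, (K s t : P1) ∉ P) ∧ (∀ t, (K 0 t : P1) = c t) ∧ ∀ t, (K 1 t : P1) = d t := by
  obtain ⟨H⟩ := h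
  obtain ⟨K, hKc, hK⟩ := exists_continuous_coe_eq (continuous_subtype_val.comp H.continuous)
    fun q (hq : (H q : P1) = _) => (H q).2 (hq ▸ hi)
  exact ⟨fun s t => K (s, t), hKc, fun s t => hK (s, t) ▸ (H (s, t)).2,
    fun t => (hK _).trans (by simp), fun t => (hK _).trans (by simp)⟩

theorem woundPoints_eq_of_homotopy {K : unitInterval → Circle → ℂ}
    (hK : Continuous fun q : unitInterval × Circle => K q.1 q.2)
    (hKP : ∀ s t, (K s t : P1) ∉ Pf) (s s' : unitInterval) :
    woundPoints (K s) = woundPoints (K s') := by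
  refine ext fun p => and_congr_right fun hp => not_congr ?_
  have key : ∀ s s', HasLogVariation (1 : Circle) 1 (fun t => K s t - p) 0 →
      HasLogVariation (1 : Circle) 1 (fun t => K s' t - p) 0 :=
    HasLogVariation.of_family (G := fun s t => K s t - p) (k := 1) (hK.sub continuous_const)
      (fun s t h => hKP s t (by rw [sub_eq_zero.1 h]; exact coe_mem_Pf.2 hp)) (by simp)
  exact ⟨key s s', key s' s⟩

theorem not_freelyHomotopic_of_mem_preimageComponents {γ δ ε : Set P1}
    (hγ : IsEssentialCurve Pf γ) (hε : IsEssentialCurve Pf ε)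
    (hδ : δ ∈ preimageComponents quartic γ) : ¬ FreelyHomotopic Pf δ ε := by
  rintro ⟨c, d, ⟨-, hc⟩, ⟨hdi, hd⟩, hcd⟩
  obtain ⟨K, hKc, hKP, hK0, hK1⟩ := exists_planar_homotopy infty_mem_Pf hcd
  have hKs : ∀ s, Continuous (K s) := fun s =>
    hKc.comp (by fun_prop : Continuous fun t => (s, t))
  have hδγ : δ ⊆ quartic ⁻¹' γ := by
    obtain ⟨x, -, rfl⟩ := hδ
    exact connectedComponentIn_subset _ _
  obtain ⟨p, hp, hw⟩ := woundPoints_of_isEssentialCurve hε (hKs 1)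
    (fun t t' h => hdi (Subtype.ext (by rw [← hK1, ← hK1, h]))) (by simp only [hK1, hd])
  rw [woundPoints_eq_of_homotopy hKc hKP 1 0] at hw
  have two : (woundPoints (K 0)).Nontrivial := by
    have three : finitePf.ncard = 3 :=
      ncard_eq_three.2 ⟨0, 1, -1, by norm_num, by norm_num, by norm_num, rfl⟩
    have finite : finitePf.Finite := finite_of_ncard_pos (by omega)
    have := (finite.subset sdiff_subset).to_subtype (s := finitePf \ {p})
    rw [hw, ← one_lt_ncard_iff_nontrivial, ncard_sdiff_singleton_of_mem hp, three]
    norm_num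
  obtain h | h := woundPoints_of_quartic_mem hγ (hKs 0) fun t =>
    hδγ (hc ▸ ⟨t, (hK0 t).symm⟩)
  · exact (hw ▸ h hp).2 rfl
  · exact h.not_nontrivial two

theorem thurstonCoeff_quartic (a b : CurveClass Pf) : thurstonCoeff quartic Pf a b = 0 := by
  have : {δ | δ ∈ preimageComponents quartic a.out.1 ∧ FreelyHomotopic Pf δ b.out.1} = ∅ :=
    eq_empty_of_forall_notMem fun δ hδ =>
      not_freelyHomotopic_of_mem_preimageComponents a.out.2 b.out.2 hδ.1 hδ.2
  rw [thurstonCoeff, this, finsum_mem_empty]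

theorem thurstonLinearMap_quartic : thurstonLinearMap quartic Pf = 0 := by
  have vanishes : (fun a : CurveClass Pf =>
      ∑ᶠ b, Finsupp.single b (thurstonCoeff quartic Pf a b)) = 0 := by
    funext a
    simp [thurstonCoeff_quartic]
  rw [thurstonLinearMap, vanishes]
  ext
  simp

/-! ### Existence of right Dehn twists -/

theorem isOrientationPreserving_of_homotopic_id {h : P1 ≃ₜ P1}
    (H : ContinuousMap.Homotopy (ContinuousMap.id P1) (h : C(P1, P1))) :
    IsOrientationPreserving h := by
  have map_id : ((AlgebraicTopology.singularHomologyFunctor (ModuleCat.{0} ℤ) 2).obj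
      (ModuleCat.of ℤ ℤ)).map (𝟙 (TopCat.of P1)) = 𝟙 _ := CategoryTheory.Functor.map_id _ _
  exact (TopCat.Homotopy.congr_homologyMap_singularChainComplexFunctor
    (X := TopCat.of P1) (Y := TopCat.of P1) (f := 𝟙 (TopCat.of P1))
    (g := TopCat.ofHom (h : C(P1, P1))) H (ModuleCat.of ℤ ℤ) 2).symm.trans map_id

theorem continuous_onePointMap_of_eq_self {T X : Type*} [TopologicalSpace T] [TopologicalSpace X]
    {u : T → X → X} {K : Set X} (hu : Continuous fun q : T × X => u q.1 q.2) (hK : IsClosed K)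
    (hKc : IsCompact K) (h : ∀ t, ∀ x ∉ K, u t x = x) :
    Continuous fun q : T × OnePoint X => OnePoint.map (u q.1) q.2 := by
  rw [continuous_iff_continuousAt]
  rintro ⟨t, x⟩
  induction x using OnePoint.rec with
  | infty =>
    have near_infty : ((↑) '' K : Set (OnePoint X))ᶜ ∈ 𝓝 OnePoint.infty :=
      (OnePoint.isOpen_compl_image_coe.2 ⟨hK, hKc⟩).mem_nhds (by simp)
    refine (continuous_snd.continuousAt (x := (t, OnePoint.infty))).congr ?_
    filter_upwards [continuous_snd.continuousAt.preimage_mem_nhds near_infty] with ⟨s, x⟩ hx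
    induction x using OnePoint.rec with
    | infty => rfl
    | coe x => exact congrArg _ (h s x fun hxK => hx ⟨x, hxK, rfl⟩).symm
  | coe x =>
    have emb : IsOpenEmbedding (Prod.map id (↑) : T × X → T × OnePoint X) :=
      IsOpenEmbedding.id.prodMap OnePoint.isOpenEmbedding_coe
    exact (emb.continuousAt_iff (x := (t, x))).1
      (OnePoint.continuous_coe.comp hu).continuousAt

theorem isOrientationPreserving_onePointCongr {τ : ℂ ≃ₜ ℂ} {r : ℝ}
    (hτ : ∀ z, r < ‖z‖ → τ z = z) : IsOrientationPreserving τ.onePointCongr := by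
  have hτc := τ.continuous
  have hF := continuous_onePointMap_of_eq_self
    (u := fun (s : unitInterval) z => z + (s : ℝ) * (τ z - z)) (by fun_prop)
    Metric.isClosed_closedBall (isCompact_closedBall (0 : ℂ) r)
    fun s z hz => by rw [hτ z (by simpa using hz), sub_self, mul_zero, add_zero]
  refine isOrientationPreserving_of_homotopic_id ⟨⟨_, hF⟩, fun x => ?_, fun x => ?_⟩
  all_goals
    induction x using OnePoint.rec with
    | infty => rfl
    | coe z => simp

/-- The extension of the right twist of the annulus `1 ≤ |z| ≤ 2` (for `σ = -1`) and of its
inverse (for `σ = 1`) to the plane: `z ↦ z exp(2πi σ t)`, where `t` is `|z| - 1` truncated to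
`[0,1]`. -/
def planeTwist (σ : ℝ) (z : ℂ) : ℂ :=
  z * Complex.exp ((σ * (2 * π * max 0 (min (‖z‖ - 1) 1)) : ℝ) * Complex.I)

theorem norm_planeTwist (σ : ℝ) (z : ℂ) : ‖planeTwist σ z‖ = ‖z‖ := by
  rw [planeTwist, norm_mul, Complex.norm_exp_ofReal_mul_I, mul_one]

theorem continuous_planeTwist (σ : ℝ) : Continuous (planeTwist σ) := by
  unfold planeTwist
  fun_prop

theorem planeTwist_planeTwist {σ σ' : ℝ} (h : σ + σ' = 0) (z : ℂ) :
    planeTwist σ (planeTwist σ' z) = z := by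
  rw [planeTwist, norm_planeTwist, planeTwist, mul_assoc, ← Complex.exp_add, ← add_mul,
    ← Complex.ofReal_add, ← add_mul, add_comm σ', h]
  simp

theorem planeTwist_of_mem_annulus {z : ℂ} (hz : z ∈ annulus) :
    planeTwist (-1) z = stdRightTwist z := by
  rw [planeTwist, stdRightTwist, min_eq_left (by linarith [hz.2]),
    max_eq_right (by linarith [hz.1]), neg_one_mul, Complex.ofReal_neg]

theorem planeTwist_of_notMem_annulus {z : ℂ} (hz : z ∉ annulus) : planeTwist (-1) z = z := by
  rw [planeTwist]
  rcases lt_or_ge ‖z‖ 1 with h | h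
  · rw [max_eq_left ((min_le_left _ _).trans (by linarith))]
    simp
  · have h2 : 2 < ‖z‖ := not_le.1 fun h2 => hz ⟨h, h2⟩
    have full_turn : Complex.exp ((-1 * (2 * π * 1) : ℝ) * Complex.I) = 1 :=
      Complex.exp_eq_one_iff.2 ⟨-1, by push_cast; ring⟩
    rw [min_eq_right (by linarith), max_eq_right zero_le_one, full_turn, mul_one]

/-- The map `planeTwist (-1)` as a homeomorphism of the plane. -/
def planeTwistHomeo : ℂ ≃ₜ ℂ where
  toFun := planeTwist (-1)
  invFun := planeTwist 1
  left_inv := planeTwist_planeTwist (by norm_num)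
  right_inv := planeTwist_planeTwist (by norm_num)
  continuous_toFun := continuous_planeTwist _
  continuous_invFun := continuous_planeTwist _

theorem preservesOrientationAt_affine {b : ℂ} (hb : b ≠ 0) (a z : ℂ) :
    PreservesOrientationAt (fun z => ((a + b * z : ℂ) : P1)) z := by
  refine ⟨a + b * z, rfl, ?_⟩
  filter_upwards [self_mem_nhdsWithin] with r (hr : 0 < r)
  refine ⟨fun t => Complex.log b + (Real.log r : ℝ) + t * Complex.I, by fun_prop,
    fun t => ?_, fun t => ?_⟩
  · rw [Complex.exp_add, Complex.exp_add, Complex.exp_log hb, ← Complex.ofReal_exp,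
      Real.exp_log hr, circleMap]
    ring_nf
  · push_cast
    ring

/-- The similarity `z ↦ 1/2 + 2z/3`, which takes the annulus `1 ≤ |z| ≤ 2` to an annulus that
separates `0, 1` from `-1`, and its core to the circle of radius `1` about `1/2`. -/
def annulusChart : ℂ ≃ₜ ℂ :=
  (Homeomorph.mulLeft₀ (2 / 3 : ℂ) (by norm_num)).trans (Homeomorph.addLeft (1 / 2 : ℂ))

theorem annulusChart_apply (z : ℂ) : annulusChart z = 1 / 2 + 2 / 3 * z := rfl

theorem norm_annulusChart_symm (w : ℂ) : ‖annulusChart.symm w‖ = 3 / 2 * ‖w - 1 / 2‖ := by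
  obtain ⟨z, rfl⟩ := annulusChart.surjective w
  rw [annulusChart.symm_apply_apply, annulusChart_apply, add_sub_cancel_left, norm_mul]
  norm_num
  ring

theorem annulusChart_image_sphere :
    annulusChart '' Metric.sphere 0 (3 / 2) = Metric.sphere (1 / 2) 1 := by
  ext w
  rw [annulusChart.image_eq_preimage_symm, mem_preimage, mem_sphere_zero_iff_norm,
    norm_annulusChart_symm, mem_sphere_iff_norm]
  constructor <;> intro h <;> linarith

theorem annulusChart_symm_notMem_annulus {w : ℂ} (hw : w ∈ finitePf) :
    annulusChart.symm w ∉ annulus := by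
  rintro ⟨h1, h2⟩
  rw [norm_annulusChart_symm] at h1 h2
  rcases hw with rfl | rfl | rfl
  · norm_num at h1
  · norm_num at h1
  · norm_num at h2

/-- A right Dehn twist about the circle of radius `1` about `1/2`. -/
def dehnTwistPlane : ℂ ≃ₜ ℂ := annulusChart.symm.trans (planeTwistHomeo.trans annulusChart)

theorem dehnTwistPlane_apply (w : ℂ) :
    dehnTwistPlane w = annulusChart (planeTwist (-1) (annulusChart.symm w)) := rfl

theorem dehnTwistPlane_eq_self {w : ℂ} (hw : annulusChart.symm w ∉ annulus) :
    dehnTwistPlane w = w := by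
  rw [dehnTwistPlane_apply, planeTwist_of_notMem_annulus hw, annulusChart.apply_symm_apply]

theorem dehnTwistPlane_mem_pureHomeo : dehnTwistPlane.onePointCongr ∈ pureHomeo Pf := by
  refine ⟨isOrientationPreserving_onePointCongr (r := 2) fun w hw => ?_, fun p hp => ?_⟩
  · refine dehnTwistPlane_eq_self fun h => ?_
    have h2 := h.2
    rw [norm_annulusChart_symm] at h2
    have := norm_sub_norm_le w (1 / 2)
    norm_num at this h2
    linarith
  · rw [Pf_eq] at hp
    obtain rfl | ⟨w, hw, rfl⟩ := hp
    · rfl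
    · exact congrArg _ (dehnTwistPlane_eq_self (annulusChart_symm_notMem_annulus hw))

theorem isRegularNhdUnitSegment_closedBall :
    IsRegularNhdUnitSegment (Metric.closedBall (1 / 2) 1) := by
  refine ⟨⟨Homeomorph.addLeft (1 / 2 : ℂ), by simp⟩, ?_, ?_⟩
  · rw [interior_closedBall _ one_ne_zero]
    refine (convex_ball _ _).segment_subset ?_ ?_ <;> rw [mem_ball_iff_norm] <;> norm_num
  · rw [mem_closedBall_iff_norm]
    norm_num

theorem isRightDehnTwist_dehnTwistPlane :
    IsRightDehnTwist Pf (boundaryCurve (Metric.closedBall (1 / 2) 1))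
      dehnTwistPlane.onePointCongr := by
  let φ : OpenPartialHomeomorph ℂ P1 := annulusChart.toOpenPartialHomeomorph.trans
    (OnePoint.isOpenEmbedding_coe (X := ℂ)).toOpenPartialHomeomorph
  have mem_image : ∀ w : ℂ, annulusChart.symm w ∈ annulus → (w : P1) ∈ φ '' annulus :=
    fun w hw => ⟨_, hw, congrArg OnePoint.some (annulusChart.apply_symm_apply w)⟩
  refine ⟨φ, by simp [φ], fun z _ _ => preservesOrientationAt_affine (by norm_num) _ z, ?_, ?_,
    fun z hz => ?_, fun x hx => ?_⟩
  · rw [boundaryCurve, frontier_closedBall _ one_ne_zero, ← annulusChart_image_sphere,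
      image_image]
    rfl
  · rw [disjoint_left]
    rintro _ ⟨z, hz, rfl⟩ hzP
    have notMem := annulusChart_symm_notMem_annulus (w := annulusChart z) (coe_mem_Pf.1 hzP)
    rw [annulusChart.symm_apply_apply] at notMem
    exact notMem hz
  · change ((dehnTwistPlane (annulusChart z) : ℂ) : P1) = _
    rw [dehnTwistPlane_apply, annulusChart.symm_apply_apply, planeTwist_of_mem_annulus hz]
    rfl
  · induction x using OnePoint.rec with
    | infty => rfl
    | coe w => exact congrArg _ (dehnTwistPlane_eq_self fun h => hx (mem_image w h))

/-! ### Degrees of loops in the punctured plane -/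

theorem exists_lift_exp {ψ : ℂ → ℂ} (hψ : ContinuousOn ψ {0}ᶜ) (h0 : ∀ z ≠ 0, ψ z ≠ 0) :
    ∃ (Ψ : ℂ → ℂ) (d : ℤ), Continuous Ψ ∧ (∀ z, Complex.exp (Ψ z) = ψ (Complex.exp z)) ∧
      ∀ (z : ℂ) (n : ℤ), Ψ (z + n * (2 * π * Complex.I)) = Ψ z + d * n * (2 * π * Complex.I) := by
  obtain ⟨Ψ, hΨ, he⟩ := exists_continuous_log (u := fun z => ψ (Complex.exp z))
    (hψ.comp_continuous Complex.continuous_exp Complex.exp_ne_zero)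
    (fun z => h0 _ (Complex.exp_ne_zero z))
  have exp_diff : ∀ z, Complex.exp (Ψ (z + 2 * π * Complex.I) - Ψ z) = 1 := fun z => by
    rw [Complex.exp_sub, he, he, Complex.exp_periodic z, ← he, div_self (Complex.exp_ne_zero _)]
  have diff_const := eq_of_exp_eq_exp (m := fun z => Ψ (z + 2 * π * Complex.I) - Ψ z) (by fun_prop)
    fun z z' => (exp_diff z).trans (exp_diff z').symm
  obtain ⟨d, hd⟩ := Complex.exp_eq_one_iff.1 (exp_diff 0)
  have periodic : Function.Periodic (fun z => Ψ z - d * z) (2 * π * Complex.I) := fun z => by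
    linear_combination diff_const z 0 + hd
  refine ⟨Ψ, d, hΨ, he, fun z n => ?_⟩
  linear_combination periodic.int_mul n z

theorem exists_degree {ψ : ℂ → ℂ} (hψ : ContinuousOn ψ {0}ᶜ) (h0 : ∀ z ≠ 0, ψ z ≠ 0) :
    ∃ d : ℤ, ∀ {Y : Type*} [TopologicalSpace Y] {y₀ y₁ : Y} {u : Y → ℂ} {k : ℤ},
      HasLogVariation y₀ y₁ u (k * (2 * π * Complex.I)) →
      HasLogVariation y₀ y₁ (fun y => ψ (u y)) (d * k * (2 * π * Complex.I)) := by
  obtain ⟨Ψ, d, hΨ, he, hd⟩ := exists_lift_exp hψ h0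
  refine ⟨d, ?_⟩
  rintro Y _ y₀ y₁ u k ⟨ℓ, hℓ, heℓ, hk⟩
  refine ⟨fun y => Ψ (ℓ y), hΨ.comp hℓ, fun y => by rw [he, heℓ], ?_⟩
  simp only [eq_add_of_sub_eq' hk, hd, add_sub_cancel_left]

theorem exists_hasLogVariation_of_circle {c : Circle → ℂ} (hc : Continuous c) (h0 : ∀ t, c t ≠ 0) :
    ∃ k : ℤ, HasLogVariation (0 : unitInterval) 1 (fun s => c (Circle.exp (2 * π * s)))
      (k * (2 * π * Complex.I)) := by
  obtain ⟨ℓ, hℓ, he⟩ := exists_continuous_log_unitInterval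
    (u := fun s => c (Circle.exp (2 * π * s))) (by fun_prop) fun s => h0 _
  have closed : Complex.exp (ℓ 1 - ℓ 0) = 1 := by
    rw [Complex.exp_sub, he, he]
    simp [h0]
  obtain ⟨k, hk⟩ := Complex.exp_eq_one_iff.1 closed
  exact ⟨k, ℓ, hℓ, he, hk⟩

/-- The radial projection of the punctured plane to the unit circle, with value `1` at `0`. -/
def radialProj (z : ℂ) : Circle := Circle.exp z.arg

theorem coe_radialProj {z : ℂ} (hz : z ≠ 0) : (radialProj z : ℂ) = z / ‖z‖ := by
  rw [radialProj, Circle.coe_exp, eq_div_iff (by simpa using hz), mul_comm,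
    Complex.norm_mul_exp_arg_mul_I]

theorem radialProj_coe (t : Circle) : radialProj t = t :=
  Circle.ext (by rw [coe_radialProj t.coe_ne_zero, Circle.norm_coe, Complex.ofReal_one, div_one])

theorem continuousOn_radialProj : ContinuousOn radialProj {0}ᶜ :=
  Topology.IsInducing.subtypeVal.continuousOn_iff.2 <|
    (continuousOn_id.div (by fun_prop) fun z hz => by simpa using hz).congr
      fun z hz => coe_radialProj hz

theorem hasLogVariation_radialProj_sub (g : Circle ≃ₜ Circle) {a : ℂ} (ha : ‖a‖ < 1) :
    HasLogVariation (0 : unitInterval) 1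
      (fun s => g.symm (radialProj (g (Circle.exp (2 * π * s)) - a))) (2 * π * Complex.I) := by
  have sub_ne_zero : ∀ (r : unitInterval) (t : Circle), (t : ℂ) - (r : ℝ) * a ≠ 0 := by
    intro r t h
    have h1 := Circle.norm_coe t
    rw [sub_eq_zero.1 h, norm_mul, Complex.norm_real, Real.norm_of_nonneg r.2.1] at h1
    nlinarith [r.2.1, r.2.2, norm_nonneg a]
  have start : HasLogVariation (0 : unitInterval) 1 (fun s => (Circle.exp (2 * π * s) : ℂ))
      (2 * π * Complex.I) :=
    ⟨fun s => (2 * π * s : ℝ) * Complex.I, by fun_prop, fun s => rfl, by simp⟩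
  have key := HasLogVariation.of_family (X := unitInterval) (Y := unitInterval) (y₀ := 0) (y₁ := 1)
    (k := 1)
    (G := fun r s => g.symm (radialProj (g (Circle.exp (2 * π * (s : ℝ))) - (r : ℝ) * a)))
    (continuous_subtype_val.comp <| g.symm.continuous.comp <|
      continuousOn_radialProj.comp_continuous (by fun_prop) fun q => sub_ne_zero _ _)
    (fun r s => Circle.coe_ne_zero _) (by simp) 0 1 (start.congr fun s => by simp [radialProj_coe])
  simpa using key

/-- The winding number is in fact `±1`; it is a unit because the loop has a left inverse up to
homotopy. -/
theorem odd_winding (Φ : ℂ ≃ₜ ℂ) (g : Circle ≃ₜ Circle) (h0 : ‖Φ.symm 0‖ < 1) :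
    ∃ k : ℤ, Odd k ∧ HasLogVariation (0 : unitInterval) 1
      (fun s => Φ (g (Circle.exp (2 * π * s)))) (k * (2 * π * Complex.I)) := by
  have sub_ne_zero : ∀ x ≠ 0, Φ.symm x - Φ.symm 0 ≠ 0 := fun x hx =>
    sub_ne_zero.2 (Φ.symm.injective.ne hx)
  obtain ⟨d, hd⟩ := exists_degree
    (ψ := fun x => g.symm (radialProj (Φ.symm x - Φ.symm 0)))
    (continuous_subtype_val.comp_continuousOn <| g.symm.continuous.comp_continuousOn <|
      continuousOn_radialProj.comp (by fun_prop) sub_ne_zero)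
    (fun x _ => Circle.coe_ne_zero _)
  obtain ⟨k, hk⟩ := exists_hasLogVariation_of_circle (c := fun t => Φ (g t)) (by fun_prop)
    fun t h => by
      rw [← h, Φ.symm_apply_apply, Circle.norm_coe] at h0
      exact lt_irrefl _ h0
  refine ⟨k, ?_, hk⟩
  have degree_mul : ((d * k : ℤ) : ℂ) * (2 * π * Complex.I) = (1 : ℤ) * (2 * π * Complex.I) := by
    push_cast
    rw [one_mul]
    exact (hd hk).unique
      ((hasLogVariation_radialProj_sub g h0).congr fun s => by rw [Φ.symm_apply_apply])
  have h1 : d * k = 1 := Int.cast_injective (mul_right_cancel₀ Complex.two_pi_I_ne_zero degree_mul)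
  exact (Int.odd_mul.1 (h1 ▸ odd_one)).2

theorem exists_circle_homeomorph {ρ : ℂ → ℂ} {r : ℝ} (hr : 0 < r)
    (hρ : ContinuousOn ρ (Metric.sphere 0 r)) (hinj : InjOn ρ (Metric.sphere 0 r))
    (himg : ρ '' Metric.sphere 0 r = Metric.sphere 0 1) :
    ∃ g : Circle ≃ₜ Circle, ∀ t, (g t : ℂ) = ρ (r * t) := by
  have mem_sphere : ∀ t : Circle, (r * t : ℂ) ∈ Metric.sphere (0 : ℂ) r := fun t => by
    rw [mem_sphere_zero_iff_norm, norm_mul, Complex.norm_real, Circle.norm_coe, mul_one,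
      Real.norm_of_nonneg hr.le]
  let g : Circle → Circle := fun t =>
    ⟨ρ (r * t), himg.subset (mem_image_of_mem ρ (mem_sphere t))⟩
  have g_cont : Continuous g :=
    (hρ.comp_continuous (by fun_prop) mem_sphere).subtype_mk _
  have g_inj : Function.Injective g := fun t t' h => Circle.ext <|
    mul_left_cancel₀ (Complex.ofReal_ne_zero.2 hr.ne') <|
      hinj (mem_sphere t) (mem_sphere t') (congrArg Subtype.val h)
  have g_surj : Function.Surjective g := fun t => by
    obtain ⟨z, hz, hzt⟩ : (t : ℂ) ∈ ρ '' Metric.sphere 0 r := himg.superset t.2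
    have hz0 : z ≠ 0 := Metric.ne_of_mem_sphere hz hr.ne'
    rw [mem_sphere_zero_iff_norm] at hz
    refine ⟨radialProj z, Circle.ext (Eq.trans ?_ hzt)⟩
    change ρ (r * radialProj z) = ρ z
    rw [coe_radialProj hz0, hz, mul_div_cancel₀ _ (Complex.ofReal_ne_zero.2 hr.ne')]
  exact ⟨Continuous.homeoOfEquivCompactToT2 (f := Equiv.ofBijective g ⟨g_inj, g_surj⟩) g_cont,
    fun t => rfl⟩

/-! ### Variation of the argument under a Dehn twist -/

theorem isCompact_annulus : IsCompact annulus :=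
  (isCompact_closedBall (0 : ℂ) 2).of_isClosed_subset
    ((isClosed_le continuous_const continuous_norm).inter
      (isClosed_le continuous_norm continuous_const))
    fun _ hz => mem_closedBall_zero_iff.2 hz.2

theorem annulus_mem_nhds {z : ℂ} (h1 : 1 < ‖z‖) (h2 : ‖z‖ < 2) : annulus ∈ 𝓝 z :=
  mem_of_superset
    (((isOpen_lt continuous_const continuous_norm).inter
      (isOpen_lt continuous_norm continuous_const)).mem_nhds ⟨h1, h2⟩)
    fun _ hz => ⟨hz.1.le, hz.2.le⟩

theorem sphere_subset_annulus : Metric.sphere (0 : ℂ) (3 / 2) ⊆ annulus := fun z hz => by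
  rw [mem_sphere_zero_iff_norm] at hz
  constructor <;> rw [hz] <;> norm_num

theorem isPreconnected_norm_preimage {I : Set ℝ} (hI : _root_.IsPreconnected I) (h : I ⊆ Ici 0) :
    IsPreconnected {z : ℂ | ‖z‖ ∈ I} := by
  have image_polar : {z : ℂ | ‖z‖ ∈ I} =
      (fun q : ℝ × ℝ => (q.1 * Circle.exp q.2 : ℂ)) '' I ×ˢ univ := by
    ext z
    constructor
    · exact fun hz => ⟨(‖z‖, z.arg), ⟨hz, trivial⟩, Complex.norm_mul_exp_arg_mul_I z⟩
    · rintro ⟨q, ⟨hq, -⟩, rfl⟩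
      have h0 : 0 ≤ q.1 := h hq
      simpa [abs_of_nonneg h0] using hq
  rw [image_polar]
  exact (hI.prod isPreconnected_univ).image _ (by fun_prop)

theorem forall_lt_or_forall_gt_of_isPreconnected {X : Type*} [TopologicalSpace X] {S : Set X}
    (hS : IsPreconnected S) {N : X → ℝ} (hN : ContinuousOn N S) {a : ℝ} (h : ∀ x ∈ S, N x ≠ a) :
    (∀ x ∈ S, N x < a) ∨ ∀ x ∈ S, a < N x := by
  by_contra! hcon
  obtain ⟨⟨x, hx, hax⟩, y, hy, hya⟩ := hcon
  obtain ⟨z, hz, hza⟩ := hS.intermediate_value hy hx hN ⟨hya, hax⟩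
  exact h z hz hza

theorem eq_of_eq_on_frontier {Y : Type*} [TopologicalSpace Y] {X A : Set Y}
    (hX : IsPreconnected X) {ℓ : Y → ℂ} (hℓ : Continuous ℓ)
    (h1 : ∀ x ∉ A, Complex.exp (ℓ x) = 1) {e : ℂ} (he : Complex.exp e = 1)
    (hfr : ∀ x ∈ X ∩ frontier A, ℓ x = e) (hne : (X ∩ A).Nonempty) {x : Y} (hx : x ∈ X)
    (hxA : x ∉ A) : ℓ x = e := by
  classical
  have : PreconnectedSpace X := Subtype.preconnectedSpace hX
  obtain ⟨y, hyX, hyA⟩ := hne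
  have hm : Continuous fun y : X => if (y : Y) ∈ A then e else ℓ y :=
    continuous_const.if (fun y hy => (hfr y ⟨y.2, continuous_subtype_val.frontier_preimage_subset
      A hy⟩).symm) (hℓ.comp continuous_subtype_val)
  have exp_eq : ∀ y : X, Complex.exp (if (y : Y) ∈ A then e else ℓ y) = 1 := fun y => by
    split_ifs with hy
    exacts [he, h1 y hy]
  simpa only [if_neg hxA, if_pos hyA] using
    eq_of_exp_eq_exp hm (fun y y' => (exp_eq y).trans (exp_eq y').symm) ⟨x, hx⟩ ⟨y, hyX⟩

section Sides

variable {ρ : OpenPartialHomeomorph ℂ ℂ}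

theorem norm_ne_one_of_mem_annulus (hs : annulus ⊆ ρ.source)
    (hcore : ρ '' Metric.sphere 0 (3 / 2) = Metric.sphere 0 1) {z : ℂ} (hz : z ∈ annulus)
    (h : ‖z‖ ≠ 3 / 2) : ‖ρ z‖ ≠ 1 := by
  intro hρ
  obtain ⟨y, hy, hyz⟩ := hcore.superset (mem_sphere_zero_iff_norm.2 hρ)
  rw [ρ.injOn (hs (sphere_subset_annulus hy)) (hs hz) hyz, mem_sphere_zero_iff_norm] at hy
  exact h hy

theorem exists_image_annulus_mem_nhds (hs : annulus ⊆ ρ.source)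
    (hcore : ρ '' Metric.sphere 0 (3 / 2) = Metric.sphere 0 1) :
    ∃ w ∈ Metric.sphere (0 : ℂ) 1, ρ '' annulus ∈ 𝓝 w := by
  have hz : (3 / 2 : ℂ) ∈ Metric.sphere (0 : ℂ) (3 / 2) := by simp
  refine ⟨ρ (3 / 2), hcore.subset (mem_image_of_mem ρ hz), ?_⟩
  refine ρ.image_mem_nhds (hs (sphere_subset_annulus hz)) (annulus_mem_nhds ?_ ?_) <;> norm_num

theorem exists_norm_lt_one (hs : annulus ⊆ ρ.source)
    (hcore : ρ '' Metric.sphere 0 (3 / 2) = Metric.sphere 0 1) : ∃ z ∈ annulus, ‖ρ z‖ < 1 := by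
  by_contra! hcon
  obtain ⟨w, hw, hmem⟩ := exists_image_annulus_mem_nhds hs hcore
  have subset : ρ '' annulus ⊆ (Metric.ball 0 1)ᶜ := by
    rintro _ ⟨z, hz, rfl⟩
    simpa using hcon z hz
  have hw' := mem_interior_iff_mem_nhds.2 (mem_of_superset hmem subset)
  rw [interior_compl, closure_ball _ one_ne_zero] at hw'
  exact hw' (Metric.sphere_subset_closedBall hw)

theorem exists_one_lt_norm (hs : annulus ⊆ ρ.source)
    (hcore : ρ '' Metric.sphere 0 (3 / 2) = Metric.sphere 0 1) : ∃ z ∈ annulus, 1 < ‖ρ z‖ := by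
  by_contra! hcon
  obtain ⟨w, hw, hmem⟩ := exists_image_annulus_mem_nhds hs hcore
  have subset : ρ '' annulus ⊆ Metric.closedBall 0 1 := by
    rintro _ ⟨z, hz, rfl⟩
    simpa using hcon z hz
  have hw' := mem_interior_iff_mem_nhds.2 (mem_of_superset hmem subset)
  rw [interior_closedBall _ one_ne_zero] at hw'
  exact (Metric.mem_ball.1 hw').ne hw

theorem forall_norm_lt_one_or_forall_one_lt_norm (hs : annulus ⊆ ρ.source)
    (hcore : ρ '' Metric.sphere 0 (3 / 2) = Metric.sphere 0 1) {I : Set ℝ}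
    (hI : _root_.IsPreconnected I) (hI12 : I ⊆ Icc 1 2) (h : 3 / 2 ∉ I) :
    (∀ z : ℂ, ‖z‖ ∈ I → ‖ρ z‖ < 1) ∨ ∀ z : ℂ, ‖z‖ ∈ I → 1 < ‖ρ z‖ := by
  have subset : {z : ℂ | ‖z‖ ∈ I} ⊆ annulus := fun z hz => hI12 hz
  exact forall_lt_or_forall_gt_of_isPreconnected
    (isPreconnected_norm_preimage hI fun r hr => zero_le_one.trans (hI12 hr).1)
    (ρ.continuousOn.mono (subset.trans hs)).norm
    fun z hz => norm_ne_one_of_mem_annulus hs hcore (subset hz) fun hz' => h (hz' ▸ hz)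

theorem annulus_sides (hs : annulus ⊆ ρ.source)
    (hcore : ρ '' Metric.sphere 0 (3 / 2) = Metric.sphere 0 1) :
    ((∀ z : ℂ, ‖z‖ = 1 → ‖ρ z‖ < 1) ∧ ∀ z : ℂ, ‖z‖ = 2 → 1 < ‖ρ z‖) ∨
    ((∀ z : ℂ, ‖z‖ = 1 → 1 < ‖ρ z‖) ∧ ∀ z : ℂ, ‖z‖ = 2 → ‖ρ z‖ < 1) := by
  have norm_core : ∀ z : ℂ, ‖z‖ = 3 / 2 → ‖ρ z‖ = 1 := fun z hz =>
    mem_sphere_zero_iff_norm.1 <| hcore.subset <|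
      mem_image_of_mem ρ (mem_sphere_zero_iff_norm.2 hz)
  have cases : ∀ z ∈ annulus, ‖z‖ ∈ Ico 1 (3 / 2) ∨ ‖z‖ = 3 / 2 ∨ ‖z‖ ∈ Ioc (3 / 2) 2 :=
    fun z hz => (lt_trichotomy ‖z‖ (3 / 2)).imp (⟨hz.1, ·⟩) (Or.imp_right (⟨·, hz.2⟩))
  have one_mem : (1 : ℝ) ∈ Ico 1 (3 / 2) := by norm_num
  have two_mem : (2 : ℝ) ∈ Ioc (3 / 2) 2 := by norm_num
  rcases forall_norm_lt_one_or_forall_one_lt_norm hs hcore (I := Ico (1 : ℝ) (3 / 2))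
    isPreconnected_Ico (fun r hr => ⟨hr.1, by linarith [hr.2]⟩) (by simp) with inner | inner <;>
  rcases forall_norm_lt_one_or_forall_one_lt_norm hs hcore (I := Ioc (3 / 2 : ℝ) 2)
    isPreconnected_Ioc (fun r hr => ⟨by linarith [hr.1], hr.2⟩) (by simp) with outer | outer
  · obtain ⟨z, hz, hlt⟩ := exists_one_lt_norm hs hcore
    rcases cases z hz with h | h | h
    exacts [absurd hlt (inner z h).not_gt, absurd (norm_core z h) hlt.ne',
      absurd hlt (outer z h).not_gt]
  · exact Or.inl ⟨fun z hz => inner z (hz ▸ one_mem), fun z hz => outer z (hz ▸ two_mem)⟩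
  · exact Or.inr ⟨fun z hz => inner z (hz ▸ one_mem), fun z hz => outer z (hz ▸ two_mem)⟩
  · obtain ⟨z, hz, hlt⟩ := exists_norm_lt_one hs hcore
    rcases cases z hz with h | h | h
    exacts [absurd hlt (inner z h).not_gt, absurd (norm_core z h) hlt.ne,
      absurd hlt (outer z h).not_gt]

end Sides

theorem frontier_image_annulus {φ : OpenPartialHomeomorph ℂ ℂ} (hs : annulus ⊆ φ.source) :
    frontier (φ '' annulus) ⊆ φ '' {z | ‖z‖ = 1 ∨ ‖z‖ = 2} := by
  have closed : IsClosed (φ '' annulus) :=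
    (isCompact_annulus.image_of_continuousOn (φ.continuousOn.mono hs)).isClosed
  rw [closed.frontier_eq]
  rintro _ ⟨⟨z, hz, rfl⟩, hint⟩
  refine ⟨z, ?_, rfl⟩
  by_contra hcon
  rw [mem_ofPred_eq, not_or] at hcon
  exact hint <| mem_interior_iff_mem_nhds.2 <| φ.image_mem_nhds (hs hz) <|
    annulus_mem_nhds (lt_of_le_of_ne hz.1 (Ne.symm hcon.1)) (lt_of_le_of_ne hz.2 hcon.2)

/-- Polar coordinates on the annulus `1 ≤ |z| ≤ 2`. The radius is truncated to `[1, 2]`, which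
makes them a map from the whole plane. -/
def annulusPolar (q : ℝ × ℝ) : ℂ := (max 1 (min q.1 2) : ℝ) * Circle.exp q.2

theorem norm_annulusPolar (q : ℝ × ℝ) : ‖annulusPolar q‖ = max 1 (min q.1 2) := by
  rw [annulusPolar, norm_mul, Circle.norm_coe, mul_one, Complex.norm_real,
    Real.norm_of_nonneg (zero_le_one.trans (le_max_left _ _))]

theorem annulusPolar_mem (q : ℝ × ℝ) : annulusPolar q ∈ annulus := by
  rw [annulus, mem_ofPred_eq, norm_annulusPolar]
  exact ⟨le_max_left _ _, max_le one_le_two (min_le_right _ _)⟩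

theorem continuous_annulusPolar : Continuous annulusPolar := by
  unfold annulusPolar
  fun_prop

theorem annulusPolar_norm_arg {z : ℂ} (hz : z ∈ annulus) : annulusPolar (‖z‖, z.arg) = z := by
  rw [annulusPolar, min_eq_left hz.2, max_eq_right hz.1, Circle.coe_exp,
    Complex.norm_mul_exp_arg_mul_I]

theorem annulusPolar_add_two_pi (r θ : ℝ) : annulusPolar (r, θ + 2 * π) = annulusPolar (r, θ) := by
  simp only [annulusPolar, Circle.exp_add_two_pi]

theorem stdRightTwist_annulusPolar (q : ℝ × ℝ) :
    stdRightTwist (annulusPolar q) =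
      annulusPolar (q.1, q.2 - 2 * π * (max 1 (min q.1 2) - 1)) := by
  rw [stdRightTwist, norm_annulusPolar, annulusPolar, annulusPolar, mul_assoc, Circle.coe_exp,
    Circle.coe_exp, ← Complex.exp_add]
  push_cast
  ring_nf

theorem exists_log_annulusPolar {u : ℂ → ℂ} (hu : ContinuousOn u annulus)
    (h0 : ∀ z ∈ annulus, u z ≠ 0) {c : ℂ}
    (hc : HasLogVariation (0 : unitInterval) 1
      (fun s => u (3 / 2 * Circle.exp (2 * π * s))) c) :
    ∃ L : ℝ × ℝ → ℂ, Continuous L ∧ (∀ q, Complex.exp (L q) = u (annulusPolar q)) ∧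
      ∀ r θ, L (r, θ + 2 * π) = L (r, θ) + c := by
  obtain ⟨L, hL, he⟩ := exists_continuous_log (u := fun q => u (annulusPolar q))
    (hu.comp_continuous continuous_annulusPolar annulusPolar_mem)
    fun q => h0 _ (annulusPolar_mem q)
  refine ⟨L, hL, he, fun r θ => ?_⟩
  have core : HasLogVariation (0 : unitInterval) 1
      (fun s => u (3 / 2 * Circle.exp (2 * π * s))) (L (3 / 2, 0 + 2 * π) - L (3 / 2, 0)) := by
    refine ⟨fun s => L (3 / 2, 2 * π * s), by fun_prop, fun s => ?_, by simp⟩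
    rw [he, annulusPolar]
    norm_num
  have exp_diff : ∀ q : ℝ × ℝ, Complex.exp (L (q.1, q.2 + 2 * π) - L q) = 1 := fun q => by
    rw [Complex.exp_sub, he, he, annulusPolar_add_two_pi, div_self (h0 _ (annulusPolar_mem q))]
  have diff_const := eq_of_exp_eq_exp (m := fun q : ℝ × ℝ => L (q.1, q.2 + 2 * π) - L q)
    (by fun_prop) (fun q q' => (exp_diff q).trans (exp_diff q').symm) (r, θ) (3 / 2, 0)
  linear_combination diff_const + core.unique hc

theorem exists_eq_on_annulus_boundary {u ℓ : ℂ → ℂ} (hu : ContinuousOn u annulus)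
    (h0 : ∀ z ∈ annulus, u z ≠ 0) {c : ℂ}
    (hc : HasLogVariation (0 : unitInterval) 1
      (fun s => u (3 / 2 * Circle.exp (2 * π * s))) c)
    (hℓ : Continuous fun q => ℓ (u (annulusPolar q)))
    (he : ∀ z ∈ annulus, Complex.exp (ℓ (u z)) * u z = u (stdRightTwist z)) :
    ∃ e, Complex.exp e = 1 ∧ (∀ z, ‖z‖ = 1 → ℓ (u z) = e) ∧ ∀ z, ‖z‖ = 2 → ℓ (u z) = e - c := by
  obtain ⟨L, hL, heL, hper⟩ := exists_log_annulusPolar hu h0 hc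
  let m : ℝ × ℝ → ℂ := fun q =>
    ℓ (u (annulusPolar q)) - (L (q.1, q.2 - 2 * π * (max 1 (min q.1 2) - 1)) - L q)
  have hm : Continuous m := hℓ.sub ((hL.comp (by fun_prop)).sub hL)
  have exp_m : ∀ q, Complex.exp (m q) = 1 := fun q => by
    have hz := annulusPolar_mem q
    rw [Complex.exp_sub, Complex.exp_sub, heL, heL, ← stdRightTwist_annulusPolar, ← he _ hz,
      mul_div_cancel_right₀ _ (h0 _ hz), div_self (Complex.exp_ne_zero _)]
  have m_const : ∀ q, m q = m (1, 0) := fun q =>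
    eq_of_exp_eq_exp hm (fun q q' => (exp_m q).trans (exp_m q').symm) q (1, 0)
  have m_inner : ∀ θ, m (1, θ) = ℓ (u (annulusPolar (1, θ))) := fun θ => by norm_num [m]
  have m_outer : ∀ θ, m (2, θ) = ℓ (u (annulusPolar (2, θ))) + c := fun θ => by
    have outer_period := hper 2 (θ - 2 * π)
    rw [sub_add_cancel] at outer_period
    norm_num [m, outer_period]
  refine ⟨m (1, 0), exp_m _, fun z hz => ?_, fun z hz => ?_⟩
  · have hpolar := annulusPolar_norm_arg (z := z) ⟨hz.ge, hz.trans_le one_le_two⟩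
    rw [← hpolar, hz, ← m_inner, m_const]
  · have hpolar := annulusPolar_norm_arg (z := z) ⟨one_le_two.trans hz.ge, hz.le⟩
    rw [← hpolar, hz, ← m_const (2, z.arg), m_outer, add_sub_cancel_right]

theorem exists_log_ratio {τ : ℂ → ℂ} (hτ : Continuous τ) (hτ0 : ∀ x ≠ 0, τ x ≠ 0)
    (hid : ∀ᶠ x in 𝓝 0, τ x = x) :
    ∃ ℓ : ℂ → ℂ, Continuous ℓ ∧ (∀ x ≠ 0, Complex.exp (ℓ x) * x = τ x) ∧
      ∀ x, τ x = x → Complex.exp (ℓ x) = 1 := by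
  -- `τ x / x`, with value `1` at `x = 0` because division by zero gives zero
  let u : ℂ → ℂ := fun x => 1 + (τ x - x) / x
  have u_eq : ∀ x ≠ 0, u x = τ x / x := fun x hx => by
    simp only [u, sub_div, div_self hx, add_sub_cancel]
  have u_eq_one : ∀ x, τ x = x → u x = 1 := fun x hx => by simp [u, hx]
  have hu : Continuous u := continuous_iff_continuousAt.2 fun x => by
    rcases eq_or_ne x 0 with rfl | hx
    · exact continuousAt_const.congr (hid.mono fun y hy => (u_eq_one y hy).symm)
    · exact continuousAt_const.add ((hτ.continuousAt.sub continuousAt_id).div continuousAt_id hx)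
  have hu0 : ∀ x, u x ≠ 0 := fun x => by
    rcases eq_or_ne x 0 with rfl | hx
    · simp [u]
    · exact u_eq x hx ▸ div_ne_zero (hτ0 x hx) hx
  obtain ⟨ℓ, hℓ, he⟩ := exists_continuous_log hu hu0
  exact ⟨ℓ, hℓ, fun x hx => by rw [he, u_eq x hx, div_mul_cancel₀ _ hx],
    fun x hx => (he x).trans (u_eq_one x hx)⟩

section Twist

variable {φ : OpenPartialHomeomorph ℂ ℂ} {Φ : ℂ ≃ₜ ℂ}

theorem symm_comp_image (hcore : φ '' Metric.sphere 0 (3 / 2) = Φ '' Metric.sphere 0 1) :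
    (fun z => Φ.symm (φ z)) '' Metric.sphere 0 (3 / 2) = Metric.sphere 0 1 := by
  rw [← image_image Φ.symm, hcore, image_image]
  simp only [Φ.symm_apply_apply, image_id']

theorem odd_winding_core (hs : annulus ⊆ φ.source)
    (hcore : φ '' Metric.sphere 0 (3 / 2) = Φ '' Metric.sphere 0 1) (h0 : ‖Φ.symm 0‖ < 1) :
    ∃ k : ℤ, Odd k ∧ HasLogVariation (0 : unitInterval) 1
      (fun s => φ (3 / 2 * Circle.exp (2 * π * s))) (k * (2 * π * Complex.I)) := by
  have hs' := sphere_subset_annulus.trans hs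
  obtain ⟨g, hg⟩ := exists_circle_homeomorph (ρ := fun z => Φ.symm (φ z)) (r := 3 / 2)
    (by norm_num) (Φ.symm.continuous.comp_continuousOn (φ.continuousOn.mono hs'))
    (Φ.symm.injective.comp_injOn (φ.injOn.mono hs'))
    (symm_comp_image hcore)
  obtain ⟨k, hk, hvar⟩ := odd_winding Φ g h0
  refine ⟨k, hk, hvar.congr fun s => ?_⟩
  rw [hg, Φ.apply_symm_apply]
  norm_num

theorem eq_of_eq_on_boundary_circles (hs : annulus ⊆ φ.source) {ℓ : ℂ → ℂ} (hℓ : Continuous ℓ)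
    (hone : ∀ x ∉ φ '' annulus, Complex.exp (ℓ x) = 1) {e : ℂ} (he : Complex.exp e = 1)
    {J : Set ℝ} (hJ : _root_.IsPreconnected J) (hJ0 : J ⊆ Ici 0)
    (hfr : ∀ z : ℂ, ‖z‖ = 1 ∨ ‖z‖ = 2 → ‖Φ.symm (φ z)‖ ∈ J → ℓ (φ z) = e)
    (hne : ∃ z ∈ annulus, ‖Φ.symm (φ z)‖ ∈ J) {x : ℂ} (hx : ‖Φ.symm x‖ ∈ J)
    (hxA : x ∉ φ '' annulus) : ℓ x = e := by
  have image_side : {x : ℂ | ‖Φ.symm x‖ ∈ J} = Φ '' {z | ‖z‖ ∈ J} := by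
    rw [Φ.image_eq_preimage_symm]
    rfl
  have preconnected : _root_.IsPreconnected {x : ℂ | ‖Φ.symm x‖ ∈ J} :=
    image_side ▸ (isPreconnected_norm_preimage hJ hJ0).image _ Φ.continuous.continuousOn
  obtain ⟨z, hz, hzJ⟩ := hne
  refine eq_of_eq_on_frontier preconnected hℓ hone he ?_ ⟨φ z, hzJ, mem_image_of_mem φ hz⟩ hx hxA
  rintro y ⟨hyJ, hy⟩
  obtain ⟨w, hw, rfl⟩ := frontier_image_annulus hs hy
  exact hfr w hw hyJ

theorem sub_eq_or_sub_eq_of_eq_on_circles (hs : annulus ⊆ φ.source)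
    (hcore : φ '' Metric.sphere 0 (3 / 2) = Φ '' Metric.sphere 0 1) {ℓ : ℂ → ℂ}
    (hℓ : Continuous ℓ) (hone : ∀ x ∉ φ '' annulus, Complex.exp (ℓ x) = 1) {e e' : ℂ}
    (he : Complex.exp e = 1) (he' : Complex.exp e' = 1) (hinner : ∀ z, ‖z‖ = 1 → ℓ (φ z) = e)
    (houter : ∀ z, ‖z‖ = 2 → ℓ (φ z) = e') {a b : ℂ} (ha : ‖Φ.symm a‖ < 1) (hb : 1 < ‖Φ.symm b‖)
    (haA : a ∉ φ '' annulus) (hbA : b ∉ φ '' annulus) :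
    ℓ a - ℓ b = e - e' ∨ ℓ a - ℓ b = e' - e := by
  have one_mem : (1 : ℂ) ∈ annulus := by constructor <;> norm_num
  have two_mem : (2 : ℂ) ∈ annulus := by constructor <;> norm_num
  have inside : ∀ {e : ℂ}, Complex.exp e = 1 →
      (∀ z : ℂ, ‖z‖ = 1 ∨ ‖z‖ = 2 → ‖Φ.symm (φ z)‖ < 1 → ℓ (φ z) = e) →
      (∃ z ∈ annulus, ‖Φ.symm (φ z)‖ < 1) → ℓ a = e := fun he hfr ⟨z, hz, hz1⟩ =>
    eq_of_eq_on_boundary_circles hs hℓ hone he (J := Ico (0 : ℝ) 1) isPreconnected_Ico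
      (fun r hr => hr.1) (fun z hz hzJ => hfr z hz hzJ.2) ⟨z, hz, norm_nonneg _, hz1⟩
      ⟨norm_nonneg _, ha⟩ haA
  have outside : ∀ {e : ℂ}, Complex.exp e = 1 →
      (∀ z : ℂ, ‖z‖ = 1 ∨ ‖z‖ = 2 → 1 < ‖Φ.symm (φ z)‖ → ℓ (φ z) = e) →
      (∃ z ∈ annulus, 1 < ‖Φ.symm (φ z)‖) → ℓ b = e := fun he hfr hne =>
    eq_of_eq_on_boundary_circles hs hℓ hone he (J := Ioi (1 : ℝ)) isPreconnected_Ioi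
      (fun r hr => zero_le_one.trans (mem_Ioi.1 hr).le) hfr hne hb hbA
  rcases annulus_sides (ρ := φ.transHomeomorph Φ.symm) hs
    (symm_comp_image hcore) with ⟨h1, h2⟩ | ⟨h1, h2⟩
  · left
    rw [inside he (fun z hz hlt => hz.elim (hinner z) fun hz2 => (hlt.not_gt (h2 z hz2)).elim)
        ⟨1, one_mem, h1 1 (by norm_num)⟩,
      outside he' (fun z hz hlt => hz.elim (fun hz1 => (hlt.not_gt (h1 z hz1)).elim) (houter z))
        ⟨2, two_mem, h2 2 (by norm_num)⟩]
  · right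
    rw [inside he' (fun z hz hlt => hz.elim (fun hz1 => (hlt.not_gt (h1 z hz1)).elim) (houter z))
        ⟨2, two_mem, h2 2 (by norm_num)⟩,
      outside he (fun z hz hlt => hz.elim (hinner z) fun hz2 => (hlt.not_gt (h2 z hz2)).elim)
        ⟨1, one_mem, h1 1 (by norm_num)⟩]

theorem exists_log_twist (hs : annulus ⊆ φ.source)
    (hcore : φ '' Metric.sphere 0 (3 / 2) = Φ '' Metric.sphere 0 1)
    (hdisj : Disjoint (φ '' annulus) finitePf) {τ : ℂ → ℂ} (hτ : Continuous τ)
    (hτ0 : ∀ x ≠ 0, τ x ≠ 0) (htw : ∀ z ∈ annulus, τ (φ z) = φ (stdRightTwist z))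
    (hid : ∀ x ∉ φ '' annulus, τ x = x) (h0 : ‖Φ.symm 0‖ < 1) (h1 : ‖Φ.symm 1‖ < 1)
    (hm : 1 < ‖Φ.symm (-1)‖) :
    ∃ ℓ : ℂ → ℂ, Continuous ℓ ∧ (∀ x ≠ 0, Complex.exp (ℓ x) * x = τ x) ∧
      ∃ k : ℤ, Odd k ∧ ℓ 1 - ℓ (-1) = k * (2 * π * Complex.I) := by
  have notMem : ∀ x ∈ finitePf, x ∉ φ '' annulus := fun x hx hxA => hdisj.le_bot ⟨hxA, hx⟩
  have hφ0 : ∀ z ∈ annulus, φ z ≠ 0 := fun z hz hz0 =>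
    notMem 0 zero_mem_finitePf (hz0 ▸ mem_image_of_mem φ hz)
  have hφ : ContinuousOn φ annulus := φ.continuousOn.mono hs
  have closed : IsClosed (φ '' annulus) := (isCompact_annulus.image_of_continuousOn hφ).isClosed
  obtain ⟨ℓ, hℓ, he, hone⟩ := exists_log_ratio hτ hτ0 <|
    mem_of_superset (closed.isOpen_compl.mem_nhds (notMem 0 zero_mem_finitePf)) hid
  obtain ⟨k, hk, hvar⟩ := odd_winding_core hs hcore h0
  obtain ⟨e, exp_e, hinner, houter⟩ := exists_eq_on_annulus_boundary hφ hφ0 hvar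
    (hℓ.comp (hφ.comp_continuous continuous_annulusPolar annulusPolar_mem))
    fun z hz => (he _ (hφ0 z hz)).trans (htw z hz)
  have exp_e' : Complex.exp (e - k * (2 * π * Complex.I)) = 1 := by
    rw [Complex.exp_sub, exp_e, Complex.exp_int_mul_two_pi_mul_I, div_one]
  refine ⟨ℓ, hℓ, he, ?_⟩
  rcases sub_eq_or_sub_eq_of_eq_on_circles hs hcore hℓ (fun x hx => hone x (hid x hx)) exp_e exp_e'
    hinner houter h1 hm (notMem 1 one_mem_finitePf) (notMem (-1) neg_one_mem_finitePf) with h | h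
  · exact ⟨k, hk, by rw [h, sub_sub_cancel]⟩
  · exact ⟨-k, hk.neg, by rw [h]; push_cast; ring⟩

end Twist

/-! ### Lifting twists through the quartic -/

theorem stdRightTwist_mem_annulus {z : ℂ} (hz : z ∈ annulus) : stdRightTwist z ∈ annulus := by
  rwa [annulus, mem_ofPred_eq, ← planeTwist_of_mem_annulus hz, norm_planeTwist]

theorem exists_planar_chart {φ : OpenPartialHomeomorph ℂ P1} {S : Set ℂ} (hs : S ⊆ φ.source)
    (h : ∀ z ∈ S, φ z ≠ OnePoint.infty) :
    ∃ φ' : OpenPartialHomeomorph ℂ ℂ, S ⊆ φ'.source ∧ ∀ z ∈ S, ((φ' z : ℂ) : P1) = φ z := by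
  let ι := (OnePoint.isOpenEmbedding_coe (X := ℂ)).toOpenPartialHomeomorph
  have mem_target : ∀ z ∈ S, φ z ∈ ι.target := fun z hz => by
    obtain ⟨w, hw⟩ := OnePoint.ne_infty_iff_exists.1 (h z hz)
    exact hw ▸ ι.map_source (x := w) trivial
  exact ⟨φ.trans ι.symm, fun z hz => ⟨hs hz, mem_target z hz⟩,
    fun z hz => ι.right_inv (mem_target z hz)⟩

theorem exists_planar_twist {P : Set P1} (hP : OnePoint.infty ∈ P) {γ : Set ℂ} {T : P1 → P1}
    (hT : IsRightDehnTwist P ((↑) '' γ) T) {τ : ℂ → ℂ} (hτ : ∀ z : ℂ, ((τ z : ℂ) : P1) = T z) :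
    ∃ φ : OpenPartialHomeomorph ℂ ℂ, annulus ⊆ φ.source ∧ φ '' Metric.sphere 0 (3 / 2) = γ ∧
      (∀ z ∈ annulus, ((φ z : ℂ) : P1) ∉ P) ∧ (∀ z ∈ annulus, τ (φ z) = φ (stdRightTwist z)) ∧
      ∀ x ∉ φ '' annulus, τ x = x := by
  obtain ⟨ψ, hs, -, hcore, hdisj, htw, hid⟩ := hT
  have notMem : ∀ z ∈ annulus, ψ z ∉ P := fun z hz h => hdisj.le_bot ⟨mem_image_of_mem _ hz, h⟩
  obtain ⟨φ, hsφ, hφ⟩ := exists_planar_chart hs fun z hz h => notMem z hz (h ▸ hP)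
  refine ⟨φ, hsφ, ?_, fun z hz => hφ z hz ▸ notMem z hz, fun z hz => ?_, fun x hx => ?_⟩
  · refine OnePoint.coe_injective.image_injective ?_
    rw [← hcore, image_image]
    exact image_congr fun z hz => hφ z (sphere_subset_annulus hz)
  · refine OnePoint.coe_injective ?_
    rw [hτ, hφ z hz, htw z hz, hφ _ (stdRightTwist_mem_annulus hz)]
  · refine OnePoint.coe_injective ((hτ x).trans (hid x ?_))
    rintro ⟨z, hz, hzx⟩
    exact hx ⟨z, hz, OnePoint.coe_injective ((hφ z hz).trans hzx)⟩

theorem IsRegularNhdUnitSegment.exists_homeomorph {D : Set ℂ} (hD : IsRegularNhdUnitSegment D) :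
    ∃ Φ : ℂ ≃ₜ ℂ, frontier D = Φ '' Metric.sphere 0 1 ∧ ‖Φ.symm 0‖ < 1 ∧ ‖Φ.symm 1‖ < 1 ∧
      1 < ‖Φ.symm (-1)‖ := by
  obtain ⟨⟨Φ, rfl⟩, hseg, hm⟩ := hD
  rw [← Φ.image_interior, interior_closedBall _ one_ne_zero, Φ.image_eq_preimage_symm] at hseg
  rw [Φ.image_eq_preimage_symm, mem_preimage, mem_closedBall_zero_iff, not_le] at hm
  exact ⟨Φ, by rw [← Φ.image_frontier, frontier_closedBall _ one_ne_zero],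
    mem_ball_zero_iff.1 (hseg (left_mem_segment ℝ _ _)),
    mem_ball_zero_iff.1 (hseg (right_mem_segment ℝ _ _)), hm⟩

theorem exists_log_of_isRightDehnTwist {D : Set ℂ} (hD : IsRegularNhdUnitSegment D)
    {T : pureHomeo Pf} (hT : IsRightDehnTwist Pf (boundaryCurve D) (T : P1 ≃ₜ P1)) {τ : ℂ → ℂ}
    (hτ : Continuous τ) (hτT : ∀ z : ℂ, ((τ z : ℂ) : P1) = (T : P1 ≃ₜ P1) z) :
    ∃ ℓ : ℂ → ℂ, Continuous ℓ ∧ (∀ x ≠ 0, Complex.exp (ℓ x) * x = τ x) ∧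
      ∃ k : ℤ, Odd k ∧ ℓ 1 - ℓ (-1) = k * (2 * π * Complex.I) := by
  obtain ⟨Φ, hΦ, h0, h1, hm⟩ := hD.exists_homeomorph
  obtain ⟨φ, hs, hcore, hdisj, htw, hid⟩ := exists_planar_twist infty_mem_Pf hT hτT
  refine exists_log_twist hs (hcore.trans hΦ) ?_ hτ (fun x hx h => hx ?_) htw hid h0 h1 hm
  · refine disjoint_left.2 ?_
    rintro _ ⟨z, hz, rfl⟩ hfin
    exact hdisj z hz (coe_mem_Pf.2 hfin)
  · refine OnePoint.coe_injective ((T : P1 ≃ₜ P1).injective ?_)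
    rw [← hτT, h, T.2.2 _ (coe_mem_Pf.2 zero_mem_finitePf)]

theorem exists_isotopy_of_mappingClass_eq {P : Set P1} {h k : pureHomeo P}
    (hclass : mappingClass P h = mappingClass P k) :
    ∃ K : unitInterval × P1 → P1, Continuous K ∧ (∀ x, K (0, x) = (h : P1 ≃ₜ P1) x) ∧
      (∀ x, K (1, x) = (k : P1 ≃ₜ P1) x) ∧ (∀ t, Function.Injective fun x => K (t, x)) ∧
      ∀ t, ∀ p ∈ P, K (t, p) = p := by
  obtain ⟨H, hH⟩ : ∃ H, IsIsotopyFromId P ((h⁻¹ * k : pureHomeo P) : P1 ≃ₜ P1) H :=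
    QuotientGroup.eq.1 hclass
  refine ⟨fun q => (h : P1 ≃ₜ P1) (H q), (h : P1 ≃ₜ P1).continuous.comp hH.continuous,
    fun x => congrArg (h : P1 ≃ₜ P1) (hH.zero x),
    fun x => (congrArg (h : P1 ≃ₜ P1) (hH.one x)).trans ((h : P1 ≃ₜ P1).apply_symm_apply _),
    fun t => (h : P1 ≃ₜ P1).injective.comp (hH.homeo t).injective,
    fun t p hp => (congrArg (h : P1 ≃ₜ P1) (hH.fixes t p hp)).trans (h.2.2 p hp)⟩

theorem coe_ne_infty_of_injective {h : P1 → P1} (hinj : Function.Injective h)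
    (hi : h OnePoint.infty = OnePoint.infty) (z : ℂ) : h z ≠ OnePoint.infty :=
  fun hz => OnePoint.coe_ne_infty z (hinj (hz.trans hi.symm))

theorem exists_planar_map {h : P1 ≃ₜ P1} (hi : h OnePoint.infty = OnePoint.infty) :
    ∃ τ : ℂ → ℂ, Continuous τ ∧ ∀ z : ℂ, ((τ z : ℂ) : P1) = h z :=
  exists_continuous_coe_eq (h.continuous.comp OnePoint.continuous_coe)
    (coe_ne_infty_of_injective h.injective hi)

theorem HasLogVariation.of_mappingClass_eq {P : Set P1} (hi : OnePoint.infty ∈ P)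
    (h0 : ((0 : ℂ) : P1) ∈ P) {h k : pureHomeo P} (hclass : mappingClass P h = mappingClass P k)
    {τ σ : ℂ → ℂ} (hτ : ∀ z : ℂ, ((τ z : ℂ) : P1) = (h : P1 ≃ₜ P1) z)
    (hσ : ∀ z : ℂ, ((σ z : ℂ) : P1) = (k : P1 ≃ₜ P1) z) {α : unitInterval → ℂ} (hα : Continuous α)
    (hα0 : ∀ s, α s ≠ 0) (hstart : (α 0 : P1) ∈ P) (hend : (α 1 : P1) ∈ P) {c : ℂ}
    (hc : HasLogVariation 0 1 (fun s => τ (α s) / α s) c) :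
    HasLogVariation 0 1 (fun s => σ (α s) / α s) c := by
  obtain ⟨K, hK, K_zero, K_one, K_inj, K_fix⟩ := exists_isotopy_of_mappingClass_eq hclass
  obtain ⟨M, hM, hMK⟩ := exists_continuous_coe_eq
    (u := fun q : unitInterval × unitInterval => K (q.1, (α q.2 : P1)))
    (hK.comp (continuous_fst.prodMk (OnePoint.continuous_coe.comp (hα.comp continuous_snd))))
    fun q => coe_ne_infty_of_injective (K_inj q.1) (K_fix q.1 _ hi) (α q.2)
  have M_ne_zero : ∀ q, M q ≠ 0 := fun q hq => hα0 q.2 <| OnePoint.coe_injective <| K_inj q.1 <| by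
    simp only [← hMK, hq, K_fix q.1 _ h0]
  have M_end : ∀ t s, (α s : P1) ∈ P → M (t, s) = α s := fun t s hs =>
    OnePoint.coe_injective ((hMK (t, s)).trans (K_fix t _ hs))
  have M_zero : ∀ s, M (0, s) = τ (α s) := fun s =>
    OnePoint.coe_injective (by rw [hMK, K_zero, hτ])
  have M_one : ∀ s, M (1, s) = σ (α s) := fun s =>
    OnePoint.coe_injective (by rw [hMK, K_one, hσ])
  have family := HasLogVariation.of_family (G := fun t s => M (t, s) / α s) (k := 1) (c := c)
    (hM.div (hα.comp continuous_snd) fun q => hα0 q.2)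
    (fun t s => div_ne_zero (M_ne_zero _) (hα0 s))
    (fun t => by rw [M_end t 1 hend, M_end t 0 hstart, div_self (hα0 1), div_self (hα0 0), one_mul])
    0 1 (hc.congr fun s => by rw [M_zero])
  exact family.congr fun s => by rw [M_one]

theorem even_of_hasLogVariation_sq {u : unitInterval → ℂ} (hu : Continuous u) (hloop : u 1 = u 0)
    {n : ℤ} (h : HasLogVariation 0 1 (fun s => u s ^ 2) (n * (2 * π * Complex.I))) : Even n := by
  have hu0 : ∀ s, u s ≠ 0 := fun s hs => h.ne_zero s (by simp [hs])
  obtain ⟨ℓ, hℓ, he⟩ := exists_continuous_log_unitInterval hu hu0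
  have closed : Complex.exp (ℓ 1 - ℓ 0) = 1 := by
    rw [Complex.exp_sub, he, he, hloop, div_self (hu0 0)]
  obtain ⟨m, hm⟩ := Complex.exp_eq_one_iff.1 closed
  have variation : HasLogVariation 0 1 u (m * (2 * π * Complex.I)) := ⟨ℓ, hℓ, he, hm⟩
  have eq := h.unique ((variation.mul variation).congr fun s => (sq (u s)).symm)
  rw [← add_mul] at eq
  exact ⟨m, by exact_mod_cast mul_right_cancel₀ Complex.two_pi_I_ne_zero eq⟩

/-- The path `f([0, 1])` from `-1` to `1`; along it we measure the variation of the argument. -/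
def quarticPath (s : unitInterval) : ℂ := 2 * Complex.I * (((s : ℝ) : ℂ) ^ 2 - kappa) ^ 2

theorem coe_quarticPath (s : unitInterval) :
    (quarticPath s : P1) = quartic (((s : ℝ) : ℂ) : P1) := rfl

theorem continuous_quarticPath : Continuous quarticPath := by
  unfold quarticPath
  fun_prop

theorem sq_sub_kappa_ne_zero (x : ℝ) : (x : ℂ) ^ 2 - kappa ≠ 0 := fun h => by
  have him := congrArg Complex.im h
  rw [Complex.sub_im, ← Complex.ofReal_pow, Complex.ofReal_im] at him
  norm_num [kappa] at him

theorem quarticPath_ne_zero (s : unitInterval) : quarticPath s ≠ 0 :=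
  mul_ne_zero two_mul_I_ne_zero (pow_ne_zero 2 (sq_sub_kappa_ne_zero s))

theorem quarticPath_zero : quarticPath 0 = -1 :=
  OnePoint.coe_injective ((coe_quarticPath 0).trans (by simpa using quartic_zero))

theorem quarticPath_one : quarticPath 1 = 1 :=
  OnePoint.coe_injective ((coe_quarticPath 1).trans (by simpa using quartic_one))

theorem exists_odd_hasLogVariation_quarticPath {D : Set ℂ} (hD : IsRegularNhdUnitSegment D)
    {T h₀ : pureHomeo Pf} (hT : IsRightDehnTwist Pf (boundaryCurve D) (T : P1 ≃ₜ P1))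
    (hclass : mappingClass Pf h₀ = mappingClass Pf T) {τ₀ : ℂ → ℂ}
    (hτ₀ : ∀ z : ℂ, ((τ₀ z : ℂ) : P1) = (h₀ : P1 ≃ₜ P1) z) :
    ∃ n : ℤ, Odd n ∧ HasLogVariation 0 1 (fun s => τ₀ (quarticPath s) / quarticPath s)
      (n * (2 * π * Complex.I)) := by
  obtain ⟨τ, hτ, hτT⟩ := exists_planar_map (T.2.2 _ infty_mem_Pf)
  obtain ⟨ℓ, hℓ, he, n, hn, hvar⟩ := exists_log_of_isRightDehnTwist hD hT hτ hτT
  refine ⟨n, hn, .of_mappingClass_eq infty_mem_Pf (coe_mem_Pf.2 zero_mem_finitePf) hclass.symm hτT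
    hτ₀ continuous_quarticPath quarticPath_ne_zero ?_ ?_
    ⟨fun s => ℓ (quarticPath s), hℓ.comp continuous_quarticPath, fun s => ?_, ?_⟩⟩
  · exact quarticPath_zero ▸ coe_mem_Pf.2 neg_one_mem_finitePf
  · exact quarticPath_one ▸ coe_mem_Pf.2 one_mem_finitePf
  · simp only [← he _ (quarticPath_ne_zero s), mul_div_cancel_right₀ _ (quarticPath_ne_zero s)]
  · simp only [quarticPath_zero, quarticPath_one, hvar]

theorem even_of_lift {h₀ k : pureHomeo Pf}
    (hk : ∀ x, (h₀ : P1 ≃ₜ P1) (quartic x) = quartic ((k : P1 ≃ₜ P1) x)) {τ₀ : ℂ → ℂ}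
    (hτ₀ : ∀ z : ℂ, ((τ₀ z : ℂ) : P1) = (h₀ : P1 ≃ₜ P1) z) {n : ℤ}
    (h : HasLogVariation 0 1 (fun s => τ₀ (quarticPath s) / quarticPath s)
      (n * (2 * π * Complex.I))) : Even n := by
  obtain ⟨σ, hσ, hσk⟩ := exists_planar_map (k.2.2 _ infty_mem_Pf)
  have fixes : ∀ z ∈ finitePf, σ z = z := fun z hz =>
    OnePoint.coe_injective ((hσk z).trans (k.2.2 _ (coe_mem_Pf.2 hz)))
  have lift : ∀ s : unitInterval,
      τ₀ (quarticPath s) = 2 * Complex.I * (σ ((s : ℝ) : ℂ) ^ 2 - kappa) ^ 2 := fun s =>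
    OnePoint.coe_injective <| by rw [hτ₀, coe_quarticPath, hk, ← hσk, quartic_coe]
  have at_end : ∀ s : unitInterval, ((s : ℝ) : ℂ) ∈ finitePf →
      (σ ((s : ℝ) : ℂ) ^ 2 - kappa) / (((s : ℝ) : ℂ) ^ 2 - kappa) = 1 := fun s hs => by
    rw [fixes _ hs, div_self (sq_sub_kappa_ne_zero s)]
  refine even_of_hasLogVariation_sq
    (u := fun s : unitInterval => (σ ((s : ℝ) : ℂ) ^ 2 - kappa) / (((s : ℝ) : ℂ) ^ 2 - kappa))
    (Continuous.div (by fun_prop) (by fun_prop) fun s => sq_sub_kappa_ne_zero s) ?_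
    (h.congr fun s => ?_)
  · exact (at_end 1 (by simpa using one_mem_finitePf)).trans
      (at_end 0 (by simpa using zero_mem_finitePf)).symm
  · rw [lift, quarticPath, mul_div_mul_left _ _ two_mul_I_ne_zero, div_pow]

theorem not_pure_lift {D : Set ℂ} (hD : IsRegularNhdUnitSegment D) {T h₀ : pureHomeo Pf}
    (hT : IsRightDehnTwist Pf (boundaryCurve D) (T : P1 ≃ₜ P1))
    (hclass : mappingClass Pf h₀ = mappingClass Pf T) (k : pureHomeo Pf) :
    ¬ ∀ x, (h₀ : P1 ≃ₜ P1) (quartic x) = quartic ((k : P1 ≃ₜ P1) x) := by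
  intro hk
  obtain ⟨τ₀, -, hτ₀⟩ := exists_planar_map (h₀.2.2 _ infty_mem_Pf)
  obtain ⟨n, hn, hvar⟩ := exists_odd_hasLogVariation_quarticPath hD hT hclass hτ₀
  exact Int.not_even_iff_odd.2 hn (even_of_lift hk hτ₀ hvar)

end DehnTwistLift

end

theorem mainTheorem8 :
    -- regular neighbourhoods `D` of `[0,1]` and right Dehn twists about `∂D` exist
    (∃ D : Set ℂ, IsRegularNhdUnitSegment D ∧
      ∃ T : pureHomeo Pf, IsRightDehnTwist Pf (boundaryCurve D) (T : P1 ≃ₜ P1)) ∧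
    -- no lift under `f` of a homeomorphism in the class of such a twist is a pure homeomorphism
    (∀ D : Set ℂ, IsRegularNhdUnitSegment D →
      ∀ T : pureHomeo Pf, IsRightDehnTwist Pf (boundaryCurve D) (T : P1 ≃ₜ P1) →
      ∀ h₀ : pureHomeo Pf, mappingClass Pf h₀ = mappingClass Pf T →
      ∀ h₁ : P1 → P1, (h₀ : P1 ≃ₜ P1) ∘ quartic = quartic ∘ h₁ →
        ¬ ∃ k : pureHomeo Pf, ⇑(k : P1 ≃ₜ P1) = h₁) ∧
    -- although `λ_f` is constant
    (∃ c, ∀ v, thurstonLinearMap quartic Pf v = c) := by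
  refine ⟨⟨_, isRegularNhdUnitSegment_closedBall, ⟨_, dehnTwistPlane_mem_pureHomeo⟩,
    isRightDehnTwist_dehnTwistPlane⟩, ?_, 0, fun v => by rw [thurstonLinearMap_quartic]; rfl⟩
  rintro D hD T hT h₀ hclass h₁ hlift ⟨k, rfl⟩
  exact not_pure_lift hD hT hclass k (congrFun hlift)
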